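/- Theorem. Let $x_1\in\mathbb R$ and $n_1,n\in\mathbb Z$ be the independent variables, write $\widetilde f$ for the shift $n_1\mapsto n_1+1$ and $\partial_1=\partial/\partial x_1$. Fix $p_i\in\mathbb C$ ($i\ge1$), and fix the remaining variables $x_3,x_5,\dots\in\mathbb R$ and $n_2,n_3,\dots\in\mathbb Z$, all but finitely many of them zero. Put $$\rho_n(k)=\exp\Big\{\sum_{j\ge0}k^{2j+1}x_{2j+1}\Big\}\prod_{i\ge1}\Big(\frac{p_i+k}{p_i-k}\Big)^{n_i}k^n,\qquad \sigma_n(k')=\exp\Big\{\sum_{j\ge0}k'^{2j+1}x_{2j+1}\Big\}\prod_{i\ge1}\Big(\frac{p_i+k'}{p_i-k'}\Big)^{n_i}(-k')^{-n},\qquad \Omega(k,k')=\frac1{k+k'}.$$ Let $D\subseteq\mathbb C^2$ be a measurable domain with a complex measure $\mathrm d\zeta=h\,\mathrm d\mu$ ($\mu$ $\sigma$-finite, $h$ measurable), and let $I\subseteq\mathbb R$ be open, such that for $x_1\in I$ the formal objects make sense: for $(k,k')\in D$ one has $k,k'\neq0$ and $k,k'\ne\pm p_i$ for every $i\ge 2$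 with $n_i\neq0$; there is $\delta>0$ with $|p_1\pm k|\ge\delta$, $|p_1\pm k'|\ge\delta$ for $(k,k')\in D$, and $|k+l'|\ge\delta$ for all $(k,k'),(l,l')\in D$; and $\iint_D\rho_n(k)k^ik'^j\sigma_n(k')\,\mathrm d\zeta(k,k')$ converges absolutely for all $x_1\in I$ and $n_1,n,i,j\in\mathbb Z$. Let $$\tau_n=\sum_{r\ge0}\frac1{r!}\iint_D\!\cdots\!\iint_D\det\big(\rho_n(k_a)\Omega(k_a,k_b')\sigma_n(k_b')\big)_{a,b=1}^r\prod_{a=1}^r\mathrm d\zeta(k_a,k_a').$$ Let $\mathbf u_n(k)=(\mathbf u_n(k)^{(i)})_{i\in\mathbb Z}$ be any family, depending on $x_1,n_1,n$, that at every $(x_1,n_1,n)$ with $x_1\in I$ and $\tau_n\ne0$ solves the linear integral equation $$\mathbf u_n(k)+\iint_D\mathrm d\zeta(l,l')\,\rho_n(k)\Omega(k,l')\sigma_n(l')\mathbf u_n(l)=\rho_n(k)\mathbf c(k),\qquad \mathbf c(k)=(k^i)_{i\in\mathbb Z},$$ for all $k$ in the first projection of $D$, each $\sigma_n(l')\mathbf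 u_n(l)^{(i)}$ being absolutely integrable against $\mathrm d\zeta$. Put $\mathbf U_n^{(i,j)}=\iint_D\mathrm d\zeta(k,k')\,\mathbf u_n(k)^{(i)}k'^j\sigma_n(k')$ and $u_n=\mathbf U_n^{(0,0)}$. Then there is a choice of $\partial_1^{-1}u_n$ such that, at every $(x_1,n_1,n)$ with $x_1\in I$ and $\tau_n\neq0$, the function $u_n$ is differentiable in $x_1$, $\partial_1(\partial_1^{-1}u_n)=u_n$ and $\exp(\partial_1^{-1}u_n)=\tau_n$ (that is, $\partial_1^{-1}u_n$ is a branch of $\ln\tau_n$); and $$\begin{aligned}\partial_1\ln(2p_1+u_n-\widetilde u_n)={}&u_{n+1}-2u_n+u_{n-1}+(2p_1+u_n-\widetilde u_n)\\&-\frac{2p_1+u_{n+1}-\widetilde u_{n+1}}{1+\exp[\partial_1^{-1}(u_{n+1}-\widetilde u_{n+1})-\partial_1^{-1}(u_n-\widetilde u_n)]}-\frac{2p_1+u_{n-1}-\widetilde u_{n-1}}{1+\exp[\partial_1^{-1}(u_{n-1}-\widetilde u_{n-1})-\partial_1^{-1}(u_n-\widetilde u_n)]}\end{aligned}$$ holds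 at every $(x_1,n_1,n)$ with $x_1\in I$ at which its terms are defined, i.e. at which $\tau_{n-1},\tau_n,\tau_{n+1},\widetilde\tau_{n-1},\widetilde\tau_n,\widetilde\tau_{n+1}$, the number $2p_1+u_n-\widetilde u_n$ and the two denominators are nonzero. Here $\partial_1^{-1}(u_m-\widetilde u_m)=\partial_1^{-1}u_m-\partial_1^{-1}\widetilde u_m$ and $\partial_1\ln f=(\partial_1f)/f$. -/

import Mathlib

open MeasureTheory

noncomputable section

/-- The data of the direct linearisation scheme.
* `p₁` is the lattice parameter of the discrete variable `n₁`.
* `q i` and `N i` are the lattice parameter `p_{i+2}` and the discrete variable `n_{i+2}`, and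
  `t j` is the continuous variable `x_{2j+3}`. These variables are kept fixed, and all but
  finitely many of them vanish.
* `D` is the domain of integration and `dζ = h dμ` the (complex) measure on it. -/
structure DLData where
  p₁ : ℂ
  q : ℕ → ℂ
  N : ℕ →₀ ℤ
  t : ℕ →₀ ℝ
  D : Set (ℂ × ℂ)
  μ : Measure (ℂ × ℂ)
  h : ℂ × ℂ → ℂ

namespace DLData

variable (S : DLData)

/-- The factor common to both plane waves:
`exp (∑_j k^{2j+1} x_{2j+1}) ∏_i ((p_i + k)/(p_i - k))^{n_i}` with `x₁ = x`, `n₁ = m`. -/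
def wave (x : ℝ) (m : ℤ) (k : ℂ) : ℂ :=
  Complex.exp (k * x + S.t.sum fun j s => k ^ (2 * j + 3) * (s : ℂ)) *
    ((S.p₁ + k) / (S.p₁ - k)) ^ m *
    S.N.prod fun i e => ((S.q i + k) / (S.q i - k)) ^ e

/-- The plane wave factor `ρ_n(k)` at `x₁ = x`, `n₁ = m`. -/
def rho (x : ℝ) (m n : ℤ) (k : ℂ) : ℂ := S.wave x m k * k ^ n

/-- The plane wave factor `σ_n(k')` at `x₁ = x`, `n₁ = m`. -/
def sigma (x : ℝ) (m n : ℤ) (k' : ℂ) : ℂ := S.wave x m k' * (-k') ^ (-n)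

/-- The kernel `Ω(k,k')`. -/
def Omega (k k' : ℂ) : ℂ := 1 / (k + k')

/-- Absolute convergence of `∬_D dζ(l,l') f(l,l')`. -/
def ZetaIntegrable (f : ℂ × ℂ → ℂ) : Prop :=
  Integrable (fun z => f z * S.h z) (S.μ.restrict S.D)

/-- The integral `∬_D dζ(l,l') f(l,l')`. -/
def zetaInt (f : ℂ × ℂ → ℂ) : ℂ := ∫ z in S.D, f z * S.h z ∂S.μ

/-- Regularity of the data for `x₁` in `I`: the plane wave factors have no zeros or poles on `D`,
the distances to `±p₁` and the denominators of the kernel are bounded below,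
and the entries `∬_D dζ(k,k') ρ_n(k) k^i k'^j σ_n(k')` of the infinite matrix `C_n` converge
absolutely. -/
structure Admissible (I : Set ℝ) : Prop where
  sigmaFinite : SigmaFinite S.μ
  measurableSet_D : MeasurableSet S.D
  measurable_h : Measurable S.h
  ne_zero : ∀ z ∈ S.D, z.1 ≠ 0 ∧ z.2 ≠ 0
  ne_q : ∀ z ∈ S.D, ∀ i ∈ S.N.support,
    z.1 ≠ S.q i ∧ z.1 ≠ -S.q i ∧ z.2 ≠ S.q i ∧ z.2 ≠ -S.q i
  separated_p : ∃ δ : ℝ, 0 < δ ∧ ∀ z ∈ S.D,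
    δ ≤ ‖S.p₁ - z.1‖ ∧ δ ≤ ‖S.p₁ + z.1‖ ∧ δ ≤ ‖S.p₁ - z.2‖ ∧ δ ≤ ‖S.p₁ + z.2‖
  separated_kernel : ∃ δ : ℝ, 0 < δ ∧ ∀ z ∈ S.D, ∀ w ∈ S.D, δ ≤ ‖z.1 + w.2‖
  integrable : ∀ x ∈ I, ∀ m n i j : ℤ,
    S.ZetaIntegrable fun z => S.rho x m n z.1 * z.1 ^ i * (z.2 ^ j * S.sigma x m n z.2)

/-- The tau function `τ_n = det (1 + Ω C_n)`, through its expansion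
`∑_r (1/r!) ∬_D ⋯ ∬_D det (ρ_n(k_a) Ω(k_a,k'_b) σ_n(k'_b))_{a,b=1}^r ∏_a dζ(k_a,k'_a)`. -/
def tau (x : ℝ) (m n : ℤ) : ℂ :=
  ∑' r : ℕ, ((r.factorial : ℂ))⁻¹ *
    ∫ z : Fin r → ℂ × ℂ,
      (Matrix.of fun a b : Fin r =>
        S.rho x m n (z a).1 * Omega (z a).1 (z b).2 * S.sigma x m n (z b).2).det *
      ∏ a, S.h (z a) ∂(Measure.pi fun _ => S.μ.restrict S.D)

/-- `u : ℂ → ℤ → ℂ`, an infinite vector `u k = (u k i)_{i ∈ ℤ}` for each `k`, solves the linear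
integral equation
`u(k) + ∬_D dζ(l,l') ρ_n(k) Ω(k,l') σ_n(l') u(l) = ρ_n(k) c(k)`, where `c(k) = (k^i)_{i ∈ ℤ}`. -/
def IsSolution (x : ℝ) (m n : ℤ) (u : ℂ → ℤ → ℂ) : Prop :=
  ∀ i : ℤ,
    (S.ZetaIntegrable fun z => S.sigma x m n z.2 * u z.1 i) ∧
    ∀ k ∈ Prod.fst '' S.D,
      u k i + S.zetaInt (fun z =>
        S.rho x m n k * Omega k z.2 * S.sigma x m n z.2 * u z.1 i) = S.rho x m n k * k ^ i

/-- The infinite potential matrix `U_n = ∬_D dζ(k,k') u_n(k) c'(k') σ_n(k')`, where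
`c'(k') = (k'^j)_{j ∈ ℤ}`. -/
def potential (x : ℝ) (m n : ℤ) (u : ℂ → ℤ → ℂ) (i j : ℤ) : ℂ :=
  S.zetaInt fun z => u z.1 i * z.2 ^ j * S.sigma x m n z.2

end DLData

end

/-!
The proof expresses everything through Fredholm determinants with the Cauchy kernel `1/(k + k')`.

*The tau function.* For a bounded kernel `A` and an integrable weight `w`, `fredholmDet` is the
series `∑_r (1/r!) ∫ det (A (z_a) (z_b)) ∏ w (z_a)`. It converges absolutely by Hadamard's
inequality, and `τ_n` is the case `A = 1/(k + k')`, `w = ρ_n σ_n h`. Since the matrix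
`Ω = (1/(k_a + k'_b))` satisfies `K Ω + Ω K' = 1 1ᵀ` with `K = diag k_a` and `K' = diag k'_a`,
differentiating `τ_n` with respect to `x₁`, which brings down the factor `∑ (k_a + k'_a)`, amounts
to adding the constant `1` to the kernel: `∂₁ τ` is a difference of two Fredholm determinants
(`Matrix.det_add_one_of_cauchy`, `fredholmMoment_one_eq`).

*The potential.* A rank one perturbation `A + c ⊗ 1` changes the determinant by the pairing of `c`
with a row of first Fredholm minors, and these minors solve the transposed integral equation up to
the factor `τ`. Pairing them with a given solution of the linear integral equation yields
`∂₁ τ_n = u_n τ_n` (`fredholmDet_add_sub`, `fredholmDet_add_one_sub`). So `u_n` is the logarithmic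
derivative of `τ_n`, and `∂₁⁻¹ u_n` is a branch of `log τ_n` on the open set where `τ_n` does not
vanish (`exists_log_branch`).

*The bilinear equations.* Let an index `a` denote the Miwa shift `w ↦ w (a - k)/(a + k')`. Then
`∂g_a · g_b - g_a · ∂g_b = (b - a) (g_a g_b - g g_{ab})` (`cauchyDet_bilinear`). After a gauge
transformation all six determinants have kernels that differ from `1/(k + k')` by a perturbation
of rank at most two with the same rows and columns, and the equation is Jacobi's determinant
identity. For finite matrices this is linear algebra (`Matrix.bilinear_det_identity`); it carries
over because a Fredholm determinant with a continuous kernel is a limit of finite determinants,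
obtained by sampling the kernel at points of the domain (`exists_tendsto_det`).

*The equation.* The shift of `n` is the Miwa shift with parameter `0`, and the shift of `n₁` is
the one with parameter `-p₁` composed with the inverse of the one with parameter `p₁`. With `f`
the inverse shift of `τ` by `p₁` and `F` the shift of `τ` by `-p₁`, the bilinear equation for
`±p₁` reads `2 p₁ + u - ũ = 2 p₁ f F / (τ τ̃)`, and the bilinear equations combine to three-term
relations that evaluate `1 + exp (…)` as a quotient of tau functions. The differential-difference
equation is then the sum of two bilinear equations, one for `F_n` and `τ_{n+1}` and one for `f_n`
and `τ_{n-1}`.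
-/

/-! ### Determinant identities and estimates -/

open scoped ComplexOrder in
/-- **Hadamard's inequality** in the entrywise form, from the inequality between the arithmetic and
geometric means of the eigenvalues of `A * Aᴴ`. -/
theorem Matrix.norm_det_le_of_norm_le {r : ℕ} (A : Matrix (Fin r) (Fin r) ℂ) {M : ℝ}
    (hA : ∀ i j, ‖A i j‖ ≤ M) : ‖A.det‖ ≤ (M * √r) ^ r := by
  rcases Nat.eq_zero_or_pos r with rfl | hr
  · simp
  have hM : 0 ≤ M := (norm_nonneg _).trans (hA ⟨0, hr⟩ ⟨0, hr⟩)
  have hr' : (0 : ℝ) < r := by exact_mod_cast hr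
  have hP : (A * A.conjTranspose).PosSemidef := Matrix.posSemidef_self_mul_conjTranspose A
  set ev := hP.isHermitian.eigenvalues with hev
  have hev0 : ∀ i, 0 ≤ ev i := hP.eigenvalues_nonneg
  have hdet : ((‖A.det‖ ^ 2 : ℝ) : ℂ) = ((∏ i, ev i : ℝ) : ℂ) := by
    have h1 := hP.isHermitian.det_eq_prod_eigenvalues
    rw [Matrix.det_mul, Matrix.det_conjTranspose] at h1
    have h2 : A.det * star A.det = ((‖A.det‖ ^ 2 : ℝ) : ℂ) := by
      rw [Complex.star_def, Complex.mul_conj, Complex.normSq_eq_norm_sq]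
    rw [← h2, h1]
    push_cast
    rfl
  have hdet' : ‖A.det‖ ^ 2 = ∏ i, ev i := by exact_mod_cast hdet
  have htr : ((∑ i, ev i : ℝ) : ℂ) = ((∑ i, ∑ j, ‖A i j‖ ^ 2 : ℝ) : ℂ) := by
    have h1 := hP.isHermitian.trace_eq_sum_eigenvalues
    push_cast
    have h3 : (∑ i, (ev i : ℂ)) = (A * A.conjTranspose).trace := h1.symm
    rw [h3, Matrix.trace]
    refine Finset.sum_congr rfl fun i _ => ?_
    rw [Matrix.diag_apply, Matrix.mul_apply]
    refine Finset.sum_congr rfl fun j _ => ?_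
    rw [Matrix.conjTranspose_apply, Complex.star_def, Complex.mul_conj, Complex.normSq_eq_norm_sq]
    push_cast
    rfl
  have htr' : ∑ i, ev i = ∑ i, ∑ j, ‖A i j‖ ^ 2 := by exact_mod_cast htr
  have htr2 : ∑ i, ev i ≤ r * (r * M ^ 2) := by
    rw [htr']
    calc ∑ i, ∑ j, ‖A i j‖ ^ 2 ≤ ∑ _i : Fin r, ∑ _j : Fin r, M ^ 2 :=
          Finset.sum_le_sum fun i _ => Finset.sum_le_sum fun j _ =>
            pow_le_pow_left₀ (norm_nonneg _) (hA i j) 2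
      _ = r * (r * M ^ 2) := by simp
  have hamgm := Real.geom_mean_le_arith_mean Finset.univ (fun _ : Fin r => (1 : ℝ)) ev
    (fun _ _ => zero_le_one) (by simpa using hr) (fun i _ => hev0 i)
  simp only [Real.rpow_one, Finset.sum_const, Finset.card_univ, Fintype.card_fin, nsmul_eq_mul,
    mul_one, one_mul] at hamgm
  have hle : ∏ i, ev i ≤ (r * M ^ 2) ^ r := by
    have h0 : 0 ≤ ∏ i, ev i := Finset.prod_nonneg fun i _ => hev0 i
    have h1 : (∏ i, ev i) ^ ((r : ℝ)⁻¹) ≤ r * M ^ 2 :=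
      hamgm.trans ((div_le_iff₀ hr').2 (by linarith))
    calc ∏ i, ev i = ((∏ i, ev i) ^ ((r : ℝ)⁻¹)) ^ r := by
          rw [Real.rpow_inv_natCast_pow h0 hr.ne']
      _ ≤ _ := pow_le_pow_left₀ (Real.rpow_nonneg h0 _) h1 r
  refine le_of_sq_le_sq ?_ (by positivity)
  rw [hdet']
  refine hle.trans (le_of_eq ?_)
  rw [← pow_mul, mul_comm r 2, pow_mul, mul_pow M, Real.sq_sqrt hr'.le, mul_comm]

/-- The injections `Fin r → n` with a given image of cardinality `r` are `r!` in number. -/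
theorem Finset.card_injective_image_eq {n : Type*} [Fintype n] [DecidableEq n] {r : ℕ}
    {s : Finset n} (hs : s.card = r) :
    (Finset.univ.filter fun c : Fin r → n =>
      Function.Injective c ∧ Finset.univ.image c = s).card = r.factorial := by
  have e : s ≃ Fin r := s.equivFinOfCardEq hs
  have h1 : Fintype.card (Fin r ≃ s) = r.factorial := by
    rw [Fintype.card_equiv e.symm, Fintype.card_fin]
  rw [← h1, ← Finset.card_univ]
  symm
  refine Finset.card_bij (fun f _ a => (f a : n)) ?_ ?_ ?_
  · intro f _
    simp only [Finset.mem_filter, Finset.mem_univ, true_and]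
    refine ⟨Subtype.val_injective.comp f.injective, ?_⟩
    ext x
    simp only [Finset.mem_image, Finset.mem_univ, true_and]
    constructor
    · rintro ⟨a, rfl⟩; exact (f a).2
    · intro hx; exact ⟨f.symm ⟨x, hx⟩, by simp⟩
  · intro f _ g _ h
    ext a
    exact congrFun h a
  · intro c hc
    simp only [Finset.mem_filter, Finset.mem_univ, true_and] at hc
    have hmem : ∀ a, c a ∈ s := fun a => hc.2 ▸ Finset.mem_image_of_mem c (Finset.mem_univ a)
    refine ⟨Equiv.ofBijective (fun a => (⟨c a, hmem a⟩ : s)) ⟨?_, ?_⟩, Finset.mem_univ _, ?_⟩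
    · intro a b hab
      exact hc.1 (by simpa using hab)
    · rintro ⟨x, hx⟩
      rw [← hc.2] at hx
      obtain ⟨a, _, ha⟩ := Finset.mem_image.1 hx
      exact ⟨a, by simpa using ha⟩
    · rfl

/-- Summing the minors over all maps `Fin r → n` counts each principal minor of size `r` exactly
`r!` times: a map that is not injective contributes a determinant with two equal rows. -/
theorem Matrix.sum_det_submatrix {n : Type*} [Fintype n] [DecidableEq n] (M : Matrix n n ℂ)
    (r : ℕ) :
    ∑ c : Fin r → n, (M.submatrix c c).det =
      r.factorial * ∑ s ∈ Finset.univ.powersetCard r,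
        (M.submatrix (Subtype.val : s → n) Subtype.val).det := by
  classical
  have h0 : ∑ c : Fin r → n, (M.submatrix c c).det =
      ∑ c ∈ Finset.univ.filter (fun c : Fin r → n => Function.Injective c),
        (M.submatrix c c).det := by
    symm
    refine Finset.sum_filter_of_ne fun c _ hc => ?_
    intro a b hab
    by_contra hne
    refine hc (Matrix.det_zero_of_row_eq hne ?_)
    ext j
    simp [hab]
  rw [h0, Finset.mul_sum,
    ← Finset.sum_fiberwise_of_maps_to (t := Finset.univ.powersetCard r)
      (g := fun c : Fin r → n => Finset.univ.image c)]
  · refine Finset.sum_congr rfl fun s hs => ?_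
    rw [Finset.mem_powersetCard] at hs
    rw [Finset.filter_filter, ← Finset.card_injective_image_eq hs.2, ← nsmul_eq_mul]
    refine Finset.sum_eq_card_nsmul fun c hc => ?_
    simp only [Finset.mem_filter, Finset.mem_univ, true_and] at hc
    have hmem : ∀ a, c a ∈ s := fun a => hc.2 ▸ Finset.mem_image_of_mem c (Finset.mem_univ a)
    let e : Fin r ≃ s := Equiv.ofBijective (fun a => (⟨c a, hmem a⟩ : s)) ⟨by
      intro a b hab
      exact hc.1 (by simpa using hab), by
      rintro ⟨x, hx⟩
      rw [← hc.2] at hx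
      obtain ⟨a, _, ha⟩ := Finset.mem_image.1 hx
      exact ⟨a, by simpa using ha⟩⟩
    rw [← Matrix.det_submatrix_equiv_self e]
    rfl
  · intro c hc
    simp only [Finset.mem_filter, Finset.mem_univ, true_and] at hc
    rw [Finset.mem_powersetCard]
    exact ⟨Finset.subset_univ _, by rw [Finset.card_image_of_injective _ hc]; simp⟩

/-- Von Koch's expansion of `det (1 + M)`. -/
theorem Matrix.hasSum_det_one_add {n : Type*} [Fintype n] [DecidableEq n] (M : Matrix n n ℂ) :
    HasSum (fun r : ℕ => ((r.factorial : ℂ))⁻¹ * ∑ c : Fin r → n, (M.submatrix c c).det)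
      (1 + M).det := by
  have h1 : ∀ r : ℕ, ((r.factorial : ℂ))⁻¹ * ∑ c : Fin r → n, (M.submatrix c c).det =
      (Matrix.det (1 + (Polynomial.X : Polynomial ℂ) • M.map Polynomial.C)).coeff r := by
    intro r
    rw [Matrix.sum_det_submatrix, Matrix.coeff_det_one_add_X_smul_eq_sum_minors,
      inv_mul_cancel_left₀ (by exact_mod_cast r.factorial_ne_zero)]
  set P := Matrix.det (1 + (Polynomial.X : Polynomial ℂ) • M.map Polynomial.C) with hP
  have h2 : (1 + M).det = P.eval 1 := by
    rw [hP, ← Polynomial.coe_evalRingHom, RingHom.map_det]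
    congr 1
    ext i j
    by_cases hij : i = j <;> simp [hij]
  simp_rw [h1]
  rw [h2, Polynomial.eval_eq_sum_range]
  simp only [one_pow, mul_one]
  refine hasSum_sum_of_ne_finset_zero fun r hr => ?_
  exact Polynomial.coeff_eq_zero_of_natDegree_lt (by simpa [Nat.lt_succ_iff] using hr)

/-- Invertible matrices are dense, so an identity between continuous functions may be checked on
them. -/
theorem Matrix.eq_of_eq_on_det_ne_zero {n : Type*} [Fintype n] [DecidableEq n]
    {P Q : Matrix n n ℂ → ℂ} (hP : Continuous P) (hQ : Continuous Q)
    (h : ∀ A : Matrix n n ℂ, A.det ≠ 0 → P A = Q A) : P = Q := by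
  funext A
  have hA : Continuous fun t : ℂ => A + t • (1 : Matrix n n ℂ) := by fun_prop
  have hfin : {t : ℂ | (A + t • (1 : Matrix n n ℂ)).det = 0}.Finite := by
    refine ((-A).charpoly.roots.toFinset.finite_toSet).subset fun t ht => ?_
    simp only [Set.mem_ofPred_eq] at ht
    simp only [Finset.mem_coe, Multiset.mem_toFinset]
    rw [Polynomial.mem_roots (Matrix.charpoly_monic _).ne_zero, Polynomial.IsRoot,
      Matrix.eval_charpoly, ← ht]
    congr 1
    rw [sub_neg_eq_add, add_comm]
    congr 1
    simp [Matrix.scalar_apply, Matrix.smul_one_eq_diagonal]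
  have hd : Dense {t : ℂ | (A + t • (1 : Matrix n n ℂ)).det = 0}ᶜ := hfin.countable.dense_compl ℂ
  have := Continuous.ext_on hd (hP.comp hA) (hQ.comp hA) fun t ht => h _ ht
  simpa using congrFun this 0

theorem Matrix.det_add_vecMulVec {n : Type*} [Fintype n] [DecidableEq n] (A : Matrix n n ℂ)
    (c r : n → ℂ) : (A + Matrix.vecMulVec c r).det = A.det + r ⬝ᵥ (A.adjugate.mulVec c) := by
  refine congrFun (Matrix.eq_of_eq_on_det_ne_zero
    (P := fun A => (A + Matrix.vecMulVec c r).det)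
    (Q := fun A => A.det + r ⬝ᵥ (A.adjugate.mulVec c)) (by fun_prop) (by fun_prop) ?_) A
  intro A hA
  have hu : IsUnit A.det := isUnit_iff_ne_zero.2 hA
  have h1 : A.adjugate = A.det • A⁻¹ := by
    rw [Matrix.inv_def, smul_smul, Ring.mul_inverse_cancel _ hu, one_smul]
  rw [Matrix.vecMulVec_eq Unit, Matrix.det_add_replicateCol_mul_replicateRow hu, h1,
    Matrix.smul_mulVec, dotProduct_smul, Matrix.mul_assoc,
    Matrix.det_unique (1 + Matrix.replicateRow Unit r * _), Matrix.add_apply,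
    Matrix.one_apply_eq, ← Matrix.replicateCol_mulVec, Matrix.replicateRow_mul_replicateCol_apply,
    smul_eq_mul]
  ring

/-- The determinant of a rank two perturbation of an invertible matrix. -/
theorem Matrix.det_add_vecMulVec_add_vecMulVec {n : Type*} [Fintype n] [DecidableEq n]
    {A : Matrix n n ℂ} (hA : A.det ≠ 0) (c r d s : n → ℂ) :
    (A + (Matrix.vecMulVec c r + Matrix.vecMulVec d s)).det =
      A.det * ((1 + r ⬝ᵥ (A⁻¹.mulVec c)) * (1 + s ⬝ᵥ (A⁻¹.mulVec d)) -
        (r ⬝ᵥ (A⁻¹.mulVec d)) * (s ⬝ᵥ (A⁻¹.mulVec c))) := by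
  have hu : IsUnit A.det := isUnit_iff_ne_zero.2 hA
  have h1 : Matrix.vecMulVec c r + Matrix.vecMulVec d s =
      (Matrix.of ![c, d]).transpose * Matrix.of ![r, s] := by
    ext i j
    simp [Matrix.mul_apply, Fin.sum_univ_two, Matrix.vecMulVec_apply]
  have h2 : ∀ i j, ((Matrix.of ![r, s] : Matrix (Fin 2) n ℂ) * A⁻¹ *
      (Matrix.of ![c, d]).transpose) i j = (![r, s] i) ⬝ᵥ (A⁻¹.mulVec (![c, d] j)) := by
    intro i j
    rw [Matrix.mul_assoc]
    rfl
  rw [h1, Matrix.det_add_mul _ _ hu, Matrix.det_fin_two]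
  simp only [Matrix.add_apply, h2]
  simp

/-- The bilinear identity for rank one perturbations of a matrix `M`: a form of Jacobi's identity
for the minors of a determinant bordered by two rows `ra`, `rb` and two columns `e`, `κ`. -/
theorem Matrix.bilinear_det_identity {n : Type*} [Fintype n] [DecidableEq n] (M : Matrix n n ℂ)
    (e κ ra rb : n → ℂ) {a b : ℂ} (hab : a ≠ b) :
    ((M + vecMulVec (a • e - e - κ) ra).det - (M - vecMulVec e ra).det) * (M - vecMulVec e rb).det -
      (M - vecMulVec e ra).det *
        ((M + vecMulVec (b • e - e - κ) rb).det - (M - vecMulVec e rb).det) =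
    (b - a) * ((M - vecMulVec e ra).det * (M - vecMulVec e rb).det - M.det *
      (M + (vecMulVec ((b - a)⁻¹ • (κ - b • e)) ra + vecMulVec ((b - a)⁻¹ • (a • e - κ)) rb)).det)
    := by
  have hba : b - a ≠ 0 := sub_ne_zero.2 hab.symm
  refine congrFun (Matrix.eq_of_eq_on_det_ne_zero
    (P := fun M => ((M + vecMulVec (a • e - e - κ) ra).det - (M - vecMulVec e ra).det) *
      (M - vecMulVec e rb).det - (M - vecMulVec e ra).det *
        ((M + vecMulVec (b • e - e - κ) rb).det - (M - vecMulVec e rb).det))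
    (Q := fun M => (b - a) * ((M - vecMulVec e ra).det * (M - vecMulVec e rb).det - M.det *
      (M + (vecMulVec ((b - a)⁻¹ • (κ - b • e)) ra +
        vecMulVec ((b - a)⁻¹ • (a • e - κ)) rb)).det)) (by fun_prop) (by fun_prop) ?_) M
  intro A hA
  have hu : IsUnit A.det := isUnit_iff_ne_zero.2 hA
  have h1 : A.adjugate = A.det • A⁻¹ := by
    rw [Matrix.inv_def, smul_smul, Ring.mul_inverse_cancel _ hu, one_smul]
  have h2 : ∀ r, A - vecMulVec e r = A + vecMulVec (-e) r := by
    intro r; rw [neg_vecMulVec, sub_eq_add_neg]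
  simp only [h2, det_add_vecMulVec_add_vecMulVec hA, det_add_vecMulVec, h1, mulVec_sub,
    mulVec_smul, mulVec_neg, dotProduct_sub, dotProduct_smul, dotProduct_neg, smul_mulVec,
    smul_eq_mul]
  field_simp
  ring

/-- If `(k i + k' j) * A i j = 1`, adding the all-ones matrix to `A` multiplies the determinant by
`1 + ∑ (k i + k' i)`: the all-ones matrix is `diagonal k * A + A * diagonal k'`, and its product
with `adj A` has trace `∑ (k i + k' i) * det A`. -/
theorem Matrix.det_add_one_of_cauchy {n : Type*} [Fintype n] [DecidableEq n] (A : Matrix n n ℂ)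
    (k k' : n → ℂ) (hA : ∀ i j, (k i + k' j) * A i j = 1) :
    (A + Matrix.of fun _ _ => 1).det = A.det + (∑ i, (k i + k' i)) * A.det := by
  have h1 : (Matrix.of fun _ _ => 1 : Matrix n n ℂ) = vecMulVec (fun _ => 1) (fun _ => 1) := by
    ext i j; simp [vecMulVec_apply]
  have h2 : (Matrix.of fun _ _ => 1 : Matrix n n ℂ) = diagonal k * A + A * diagonal k' := by
    ext i j
    rw [add_apply, diagonal_mul, mul_diagonal, of_apply, ← hA i j]
    ring
  rw [h1, det_add_vecMulVec]
  congr 1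
  have h3 : (fun _ => 1 : n → ℂ) ⬝ᵥ (A.adjugate.mulVec fun _ => 1) =
      (A.adjugate * Matrix.of fun _ _ => 1).trace := by
    simp [dotProduct, mulVec, trace, mul_apply]
  rw [h3, h2, Matrix.mul_add, trace_add, ← Matrix.mul_assoc, ← Matrix.mul_assoc,
    Matrix.trace_mul_comm (A.adjugate * diagonal k), ← Matrix.mul_assoc, mul_adjugate,
    adjugate_mul, Finset.sum_add_distrib]
  simp only [trace, diag_apply, mul_diagonal, Matrix.smul_apply, one_apply_eq, smul_eq_mul, mul_one,
    ← Finset.mul_sum]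
  ring

theorem Matrix.det_add_vecMulVec_eq_sum {n : Type*} [Fintype n] [DecidableEq n] (A : Matrix n n ℂ)
    (c r : n → ℂ) :
    (A + vecMulVec c r).det = A.det + ∑ i, c i * (A.updateRow i r).det := by
  rw [det_add_vecMulVec]
  congr 1
  have h : ∀ i, (A.updateRow i r).det = ∑ j, r j * A.adjugate j i := by
    intro i
    rw [← cramer_transpose_apply, cramer_eq_adjugate_mulVec, ← adjugate_transpose]
    simp [mulVec, dotProduct, mul_comm]
  simp only [h, dotProduct, mulVec, Finset.mul_sum]
  rw [Finset.sum_comm]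
  refine Finset.sum_congr rfl fun i _ => Finset.sum_congr rfl fun j _ => ?_
  ring

/-- A determinant one of whose rows consists of ones is computed by subtracting the column through
the diagonal entry of this row from the other columns. -/
theorem Matrix.det_updateRow_one {r : ℕ} (A : Matrix (Fin (r + 1)) (Fin (r + 1)) ℂ)
    (i : Fin (r + 1)) :
    (A.updateRow i fun _ => 1).det =
      (Matrix.of fun a b => A (i.succAbove a) (i.succAbove b) - A (i.succAbove a) i).det := by
  set B := A.updateRow i fun _ => 1 with hB
  have h1 : B.det = (Matrix.of fun a b => if b = i then B a b else B a b - B a i).det := by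
    rw [← det_transpose B, ← det_transpose (of _)]
    refine det_eq_of_forall_row_eq_smul_add_const (fun b => if b = i then 0 else 1) i (by simp) ?_
    intro b a
    by_cases hb : b = i <;> simp [hb]
  rw [h1, det_succ_row _ i, Finset.sum_eq_single i]
  · rw [Even.neg_one_pow ⟨_, rfl⟩, of_apply, if_pos rfl, hB, updateRow_self, one_mul, one_mul]
    congr 1
    ext a b
    simp [Fin.succAbove_ne]
  · intro j _ hj
    rw [of_apply, if_neg hj, hB, updateRow_self]
    simp
  · simp

/-! ### Fredholm determinants of bounded kernels -/

/-- `∑_r (K √r)^r / r!` majorises the Fredholm series, by Hadamard's inequality. -/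
theorem summable_hadamard_bound (K : ℝ) :
    Summable fun r : ℕ => ((r.factorial : ℝ))⁻¹ * (K * √r) ^ r := by
  have hs : Summable fun r : ℕ => (4 * K ^ 2 * Real.exp 1) ^ r / r.factorial + (1 / 4 : ℝ) ^ r :=
    (Real.summable_pow_div_factorial _).add
      (summable_geometric_of_lt_one (by norm_num) (by norm_num))
  refine Summable.of_norm_bounded hs fun r => ?_
  have hf : (0 : ℝ) < r.factorial := by exact_mod_cast r.factorial_pos
  set s := (4 * K ^ 2 * Real.exp 1) ^ r / r.factorial with hsdef
  have hs0 : 0 ≤ s := by positivity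
  have ht0 : (0 : ℝ) < (1 / 4) ^ r := by positivity
  refine abs_le_of_sq_le_sq' ?_ (by positivity) |> abs_le.2
  have h1 : ((r.factorial : ℝ)⁻¹ * (K * √r) ^ r) ^ 2 ≤ s * (1 / 4) ^ r := by
    have h2 : ((r : ℝ)) ^ r / r.factorial ≤ Real.exp 1 ^ r := by
      rw [← Real.exp_nat_mul, mul_one]
      exact Real.pow_div_factorial_le_exp _ (Nat.cast_nonneg r) r
    have h3 : ((r.factorial : ℝ)⁻¹ * (K * √r) ^ r) ^ 2 =
        (K ^ 2) ^ r * (((r : ℝ)) ^ r / r.factorial) / r.factorial := by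
      rw [mul_pow, ← pow_mul, mul_comm r 2, pow_mul, mul_pow K, Real.sq_sqrt (Nat.cast_nonneg r),
        mul_pow]
      field_simp
    have h4 : s * (1 / 4) ^ r = (K ^ 2) ^ r * Real.exp 1 ^ r / r.factorial := by
      rw [hsdef, mul_pow, mul_pow, one_div, inv_pow]
      field_simp
    rw [h3, h4]
    gcongr
  nlinarith

section Fredholm

variable {X : Type*} [MeasurableSpace X]

/-- The Fredholm determinant `det (1 + A w)` of the integral operator with kernel `A` and weight `w`
with respect to `μ`, given by its expansion
`∑_r (1/r!) ∫ ⋯ ∫ det (A (z_a) (z_b))_{a,b=1}^r ∏_a w (z_a) dμ (z_a)`. -/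
noncomputable def fredholmDet (μ : Measure X) (w : X → ℂ) (A : X → X → ℂ) : ℂ :=
  ∑' r : ℕ, ((r.factorial : ℂ))⁻¹ *
    ∫ z : Fin r → X, (Matrix.of fun a b => A (z a) (z b)).det * ∏ a, w (z a) ∂Measure.pi fun _ => μ

/-- An integrable weight concentrated on `D`. -/
structure IsWeight (μ : Measure X) (D : Set X) (w : X → ℂ) : Prop where
  integrable : Integrable w μ
  eq_zero : ∀ z, z ∉ D → w z = 0

/-- A measurable kernel that is bounded by `M` on `D × D`. -/
structure IsBddKernel (D : Set X) (M : ℝ) (A : X → X → ℂ) : Prop where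
  measurable : Measurable fun p : X × X => A p.1 p.2
  bound : ∀ z ∈ D, ∀ y ∈ D, ‖A z y‖ ≤ M

variable {μ : Measure X} {D : Set X} {w : X → ℂ} {A : X → X → ℂ} {M : ℝ}

theorem IsBddKernel.measurable_det (hA : Measurable fun p : X × X => A p.1 p.2)
    (r : ℕ) : Measurable fun z : Fin r → X => (Matrix.of fun a b => A (z a) (z b)).det := by
  simp only [Matrix.det_apply, Matrix.of_apply]
  refine Finset.measurable_fun_sum _ fun σ _ => ?_
  refine Measurable.const_smul (Finset.measurable_fun_prod _ fun i _ => ?_) _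
  exact hA.comp (f := fun z : Fin r → X => (z (σ i), z i))
    ((measurable_pi_apply _).prodMk (measurable_pi_apply _))

theorem IsWeight.prod_eq_zero (hw : IsWeight μ D w) {r : ℕ} {z : Fin r → X}
    (hz : ¬ ∀ a, z a ∈ D) : ∏ a, w (z a) = 0 := by
  push Not at hz
  obtain ⟨a, ha⟩ := hz
  exact Finset.prod_eq_zero (Finset.mem_univ a) (hw.eq_zero _ ha)

theorem norm_det_mul_prod_le (hw : IsWeight μ D w) (hA : ∀ z ∈ D, ∀ y ∈ D, ‖A z y‖ ≤ M)
    {r : ℕ} (z : Fin r → X) :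
    ‖(Matrix.of fun a b => A (z a) (z b)).det * ∏ a, w (z a)‖ ≤
      (M * √r) ^ r * ∏ a, ‖w (z a)‖ := by
  by_cases hz : ∀ a, z a ∈ D
  · rw [norm_mul, norm_prod]
    gcongr
    exact Matrix.norm_det_le_of_norm_le _ fun i j => hA _ (hz i) _ (hz j)
  · have h0 := hw.prod_eq_zero hz
    rw [h0, mul_zero, norm_zero, ← norm_prod, h0]
    simp

/-- Factors depending on one of the two variables only may be moved between kernel and weight. -/
theorem fredholmDet_congr_gauge {w' : X → ℂ} {A' : X → X → ℂ} (p q : X → ℂ)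
    (hw : ∀ z, z ∉ D → w z = 0) (hw' : ∀ z, z ∉ D → w' z = 0)
    (hA : ∀ z ∈ D, ∀ y ∈ D, A' z y = p z * A z y * q y)
    (hp : ∀ z ∈ D, w z = p z * q z * w' z) :
    fredholmDet μ w A = fredholmDet μ w' A' := by
  unfold fredholmDet
  congr 1
  ext r
  congr 2
  ext z
  by_cases hz : ∀ a, z a ∈ D
  · have h1 : (Matrix.of fun a b => A' (z a) (z b)).det =
        (∏ a, p (z a)) * ((∏ a, q (z a)) * (Matrix.of fun a b => A (z a) (z b)).det) := by
      rw [← Matrix.det_mul_row, ← Matrix.det_mul_column]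
      congr 1
      ext a b
      simp only [Matrix.of_apply, hA _ (hz a) _ (hz b)]
      ring
    have h2 : ∏ a, w (z a) = (∏ a, p (z a)) * (∏ a, q (z a)) * ∏ a, w' (z a) := by
      rw [← Finset.prod_mul_distrib, ← Finset.prod_mul_distrib]
      exact Finset.prod_congr rfl fun a _ => hp _ (hz a)
    rw [h1, h2]
    ring
  · push Not at hz
    obtain ⟨a, ha⟩ := hz
    rw [Finset.prod_eq_zero (Finset.mem_univ a) (hw _ ha),
      Finset.prod_eq_zero (Finset.mem_univ a) (hw' _ ha), mul_zero, mul_zero]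

variable [SigmaFinite μ]

theorem IsWeight.integrable_prod_norm (hw : IsWeight μ D w) (r : ℕ) :
    Integrable (fun z : Fin r → X => ∏ a, ‖w (z a)‖) (Measure.pi fun _ => μ) :=
  Integrable.fintype_prod fun _ => hw.integrable.norm

theorem IsWeight.aestronglyMeasurable_prod (hw : IsWeight μ D w) (r : ℕ) :
    AEStronglyMeasurable (fun z : Fin r → X => ∏ a, w (z a)) (Measure.pi fun _ => μ) :=
  (Integrable.fintype_prod (f := fun _ => w) fun _ => hw.integrable).aestronglyMeasurable

theorem integrable_det_mul_prod (hw : IsWeight μ D w) (hA : IsBddKernel D M A) (r : ℕ) :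
    Integrable (fun z : Fin r → X => (Matrix.of fun a b => A (z a) (z b)).det * ∏ a, w (z a))
      (Measure.pi fun _ => μ) :=
  ((hw.integrable_prod_norm r).const_mul ((M * √r) ^ r)).mono'
    ((IsBddKernel.measurable_det hA.measurable r).aestronglyMeasurable.mul
      (hw.aestronglyMeasurable_prod r))
    (.of_forall fun z => norm_det_mul_prod_le hw hA.bound z)

theorem integral_prod_norm (w : X → ℂ) (r : ℕ) :
    ∫ z : Fin r → X, ∏ a, ‖w (z a)‖ ∂(Measure.pi fun _ => μ) = (∫ z, ‖w z‖ ∂μ) ^ r := by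
  rw [integral_fintype_prod_eq_prod (fun _ : Fin r => fun z => ‖w z‖)]
  simp

theorem norm_fredholm_term_le (hw : IsWeight μ D w) (hA : ∀ z ∈ D, ∀ y ∈ D, ‖A z y‖ ≤ M)
    (r : ℕ) :
    ‖((r.factorial : ℂ))⁻¹ * ∫ z : Fin r → X, (Matrix.of fun a b => A (z a) (z b)).det *
      ∏ a, w (z a) ∂Measure.pi fun _ => μ‖ ≤
    ((r.factorial : ℝ))⁻¹ * ((M * ∫ z, ‖w z‖ ∂μ) * √r) ^ r := by
  rw [norm_mul, norm_inv, Complex.norm_natCast]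
  gcongr
  refine (norm_integral_le_of_norm_le ((hw.integrable_prod_norm r).const_mul _)
    (.of_forall fun z => norm_det_mul_prod_le hw hA z)).trans (le_of_eq ?_)
  rw [integral_const_mul, integral_prod_norm, ← mul_pow]
  ring

theorem summable_fredholm (hw : IsWeight μ D w) (hA : ∀ z ∈ D, ∀ y ∈ D, ‖A z y‖ ≤ M) :
    Summable fun r : ℕ => ((r.factorial : ℂ))⁻¹ * ∫ z : Fin r → X,
      (Matrix.of fun a b => A (z a) (z b)).det * ∏ a, w (z a) ∂Measure.pi fun _ => μ :=
  .of_norm_bounded (summable_hadamard_bound _) (norm_fredholm_term_le hw hA)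

theorem hasSum_fredholmDet (hw : IsWeight μ D w) (hA : ∀ z ∈ D, ∀ y ∈ D, ‖A z y‖ ≤ M) :
    HasSum (fun r : ℕ => ((r.factorial : ℂ))⁻¹ * ∫ z : Fin r → X,
      (Matrix.of fun a b => A (z a) (z b)).det * ∏ a, w (z a) ∂Measure.pi fun _ => μ)
      (fredholmDet μ w A) :=
  (summable_fredholm hw hA).hasSum

theorem norm_fredholmDet_le (hw : IsWeight μ D w) (hA : ∀ z ∈ D, ∀ y ∈ D, ‖A z y‖ ≤ M) :
    ‖fredholmDet μ w A‖ ≤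
      ∑' r : ℕ, ((r.factorial : ℝ))⁻¹ * ((M * ∫ z, ‖w z‖ ∂μ) * √r) ^ r :=
  tsum_of_norm_bounded (summable_hadamard_bound _).hasSum (norm_fredholm_term_le hw hA)

/-- Fredholm determinants depend continuously on the kernel, for pointwise convergence of uniformly
bounded kernels. -/
theorem tendsto_fredholmDet (hw : IsWeight μ D w) {B : ℕ → X → X → ℂ}
    (hB : ∀ N, IsBddKernel D M (B N))
    (hlim : ∀ z ∈ D, ∀ y ∈ D, Filter.Tendsto (fun N => B N z y) Filter.atTop (nhds (A z y))) :
    Filter.Tendsto (fun N => fredholmDet μ w (B N)) Filter.atTop (nhds (fredholmDet μ w A)) := by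
  refine tendsto_tsum_of_dominated_convergence (summable_hadamard_bound (M * ∫ z, ‖w z‖ ∂μ))
    (fun r => ?_) (.of_forall fun N r => norm_fredholm_term_le hw (hB N).bound r)
  refine Filter.Tendsto.const_mul _ ?_
  refine tendsto_integral_of_dominated_convergence (fun z => (M * √r) ^ r * ∏ a, ‖w (z a)‖)
    (fun N => (integrable_det_mul_prod hw (hB N) r).aestronglyMeasurable)
    ((hw.integrable_prod_norm r).const_mul _)
    (fun N => .of_forall fun z => norm_det_mul_prod_le hw (hB N).bound z)
    (.of_forall fun z => ?_)
  by_cases hz : ∀ a, z a ∈ D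
  · refine Filter.Tendsto.mul_const _ ?_
    have hdet : Continuous fun m : Matrix (Fin r) (Fin r) ℂ => m.det := by fun_prop
    refine (hdet.tendsto _).comp ?_
    exact tendsto_pi_nhds.2 fun a => tendsto_pi_nhds.2 fun b => hlim _ (hz a) _ (hz b)
  · simp only [hw.prod_eq_zero hz, mul_zero]
    exact tendsto_const_nhds

end Fredholm

/-! ### Approximation of Fredholm determinants by finite determinants -/

section Discretization

open Filter Topology

variable {X : Type*} [MeasurableSpace X] {μ : Measure X} {D : Set X} {w : X → ℂ}

open Classical in
/-- If the kernel only depends on the values of a simple function, its Fredholm determinant is the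
determinant of a finite matrix. -/
theorem fredholmDet_comp_simpleFunc [SigmaFinite μ] (hw : Integrable w μ) (φ : SimpleFunc X X)
    (B : X → X → ℂ) :
    fredholmDet μ w (fun z y => B (φ z) (φ y)) =
      (1 + Matrix.of fun i j : φ.range => B i j * ∫ z in φ ⁻¹' {(j : X)}, w z ∂μ).det := by
  set W : φ.range → ℂ := fun j => ∫ z in φ ⁻¹' {(j : X)}, w z ∂μ with hW
  set m : Matrix φ.range φ.range ℂ := Matrix.of fun i j => B i j * W j with hm
  rw [← (Matrix.hasSum_det_one_add m).tsum_eq, fredholmDet]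
  congr 1
  ext r
  congr 1
  have hsub : ∀ c : Fin r → φ.range, (m.submatrix c c).det =
      (Matrix.of fun a b => B (c a) (c b)).det * ∏ a, W (c a) := by
    intro c
    rw [mul_comm, ← Matrix.det_mul_row]
    congr 1
    ext a b
    simp [hm, mul_comm]
  have hmeas : ∀ j : φ.range, MeasurableSet (φ ⁻¹' {(j : X)}) := fun j => φ.measurableSet_fiber _
  have hpt : ∀ z : Fin r → X,
      (Matrix.of fun a b => B (φ (z a)) (φ (z b))).det * ∏ a, w (z a) =
        ∑ c : Fin r → φ.range, (Matrix.of fun a b => B (c a) (c b)).det *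
          ∏ a, (φ ⁻¹' {(c a : X)}).indicator w (z a) := by
    intro z
    rw [Finset.sum_eq_single fun a => (⟨φ (z a), φ.mem_range_self _⟩ : φ.range)]
    · congr 1
      refine Finset.prod_congr rfl fun a _ => ?_
      rw [Set.indicator_of_mem]
      simp
    · intro c _ hc
      obtain ⟨a, ha⟩ := Function.ne_iff.1 hc
      rw [Finset.prod_eq_zero (Finset.mem_univ a), mul_zero]
      refine Set.indicator_of_notMem (fun h => ha ?_) _
      ext
      exact h.symm
    · simp
  simp_rw [hpt, hsub]
  rw [integral_finsetSum]
  · refine Finset.sum_congr rfl fun c _ => ?_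
    rw [integral_const_mul,
      integral_fintype_prod_eq_prod (fun a z => (φ ⁻¹' {(c a : X)}).indicator w z)]
    congr 1
    exact Finset.prod_congr rfl fun a _ => integral_indicator (hmeas _)
  · intro c _
    exact (Integrable.fintype_prod (f := fun a z => (φ ⁻¹' {(c a : X)}).indicator w z)
      fun a => hw.indicator (hmeas _)).const_mul _

/-- A measurable kernel that is bounded and continuous on `D × D`. -/
structure IsCtsKernel [TopologicalSpace X] (D : Set X) (A : X → X → ℂ) : Prop where
  measurable : Measurable fun p : X × X => A p.1 p.2
  bounded : ∃ M, ∀ z ∈ D, ∀ y ∈ D, ‖A z y‖ ≤ M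
  continuousOn : ContinuousOn (fun p : X × X => A p.1 p.2) (D ×ˢ D)

/-- A measurable function that is bounded and continuous on `D`. -/
structure IsCtsFun [TopologicalSpace X] (D : Set X) (c : X → ℂ) : Prop where
  measurable : Measurable c
  bounded : ∃ M, ∀ z ∈ D, ‖c z‖ ≤ M
  continuousOn : ContinuousOn c D

theorem IsCtsKernel.add_mul [TopologicalSpace X] {A : X → X → ℂ} {c r : X → ℂ}
    (hA : IsCtsKernel D A) (hc : IsCtsFun D c) (hr : IsCtsFun D r) :
    IsCtsKernel D fun z y => A z y + c z * r y where
  measurable := hA.measurable.add ((hc.measurable.comp measurable_fst).mul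
    (hr.measurable.comp measurable_snd))
  bounded := by
    obtain ⟨M, hM⟩ := hA.bounded
    obtain ⟨P, hP⟩ := hc.bounded
    obtain ⟨Q, hQ⟩ := hr.bounded
    refine ⟨M + P * Q, fun z hz y hy => (norm_add_le _ _).trans (add_le_add (hM z hz y hy) ?_)⟩
    rw [norm_mul]
    exact mul_le_mul (hP z hz) (hQ y hy) (norm_nonneg _) ((norm_nonneg _).trans (hP z hz))
  continuousOn := hA.continuousOn.add
    ((hc.continuousOn.comp continuous_fst.continuousOn fun p hp => hp.1).mul
      (hr.continuousOn.comp continuous_snd.continuousOn fun p hp => hp.2))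

theorem IsCtsFun.sub [TopologicalSpace X] {c d : X → ℂ} (hc : IsCtsFun D c) (hd : IsCtsFun D d) :
    IsCtsFun D fun z => c z - d z where
  measurable := hc.measurable.sub hd.measurable
  bounded := by
    obtain ⟨P, hP⟩ := hc.bounded
    obtain ⟨Q, hQ⟩ := hd.bounded
    exact ⟨P + Q, fun z hz => (norm_sub_le _ _).trans (add_le_add (hP z hz) (hQ z hz))⟩
  continuousOn := hc.continuousOn.sub hd.continuousOn

theorem IsCtsFun.const_mul [TopologicalSpace X] {c : X → ℂ} (hc : IsCtsFun D c) (a : ℂ) :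
    IsCtsFun D fun z => a * c z where
  measurable := hc.measurable.const_mul a
  bounded := by
    obtain ⟨P, hP⟩ := hc.bounded
    refine ⟨‖a‖ * P, fun z hz => ?_⟩
    rw [norm_mul]
    gcongr
    exact hP z hz
  continuousOn := continuousOn_const.mul hc.continuousOn

open Classical in
/-- Fredholm determinants of continuous kernels are limits of determinants of finite matrices. The
sample points and their weights do not depend on the kernel, so that polynomial identities between
finite determinants carry over to Fredholm determinants. -/
theorem exists_tendsto_det [MetricSpace X] [SecondCountableTopology X] [BorelSpace X]
    [SigmaFinite μ] (hw : IsWeight μ D w) :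
    ∃ (C : ℕ → Finset X) (W : ℕ → X → ℂ), ∀ B : X → X → ℂ, IsCtsKernel D B →
      Tendsto (fun N => (1 + Matrix.of fun i j : C N => B i j * W N j).det) atTop
        (𝓝 (fredholmDet μ w B)) := by
  rcases D.eq_empty_or_nonempty with hD | ⟨z₀, hz₀⟩
  · refine ⟨fun _ => ∅, fun _ _ => 0, fun B _ => ?_⟩
    have h1 : fredholmDet μ w B = 1 := by
      rw [fredholmDet, tsum_eq_single 0]
      · simp [Measure.real]
      · intro r hr
        have : ∀ z : Fin r → X, ∏ a, w (z a) = 0 := fun z =>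
          hw.prod_eq_zero fun h => by simpa [hD] using h ⟨0, Nat.pos_of_ne_zero hr⟩
        simp [this]
    have h2 : ∀ m : Matrix (∅ : Finset X) (∅ : Finset X) ℂ, m.det = 1 := fun m =>
      Matrix.det_isEmpty
    rw [h1]
    simp only [h2]
    exact tendsto_const_nhds
  · set φ : ℕ → SimpleFunc X X := SimpleFunc.approxOn id measurable_id D z₀ hz₀ with hφ
    have hmem : ∀ N z, φ N z ∈ D := fun N z => SimpleFunc.approxOn_mem measurable_id hz₀ N z
    refine ⟨fun N => (φ N).range, fun N x => ∫ z in φ N ⁻¹' {x}, w z ∂μ, fun B hB => ?_⟩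
    simp_rw [← fredholmDet_comp_simpleFunc hw.integrable]
    obtain ⟨M, hM⟩ := hB.bounded
    refine tendsto_fredholmDet (M := M) hw (fun N => ⟨?_, ?_⟩) fun z hz y hy => ?_
    · exact hB.measurable.comp (((φ N).measurable.comp measurable_fst).prodMk
        ((φ N).measurable.comp measurable_snd))
    · exact fun z _ y _ => hM _ (hmem N z) _ (hmem N y)
    · have hlim : ∀ x ∈ D, Tendsto (fun N => φ N x) atTop (𝓝 x) := fun x hx =>
        SimpleFunc.tendsto_approxOn measurable_id hz₀ (subset_closure hx)
      have h1 : Tendsto (fun N => (φ N z, φ N y)) atTop (𝓝[D ×ˢ D] (z, y)) :=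
        tendsto_nhdsWithin_iff.2 ⟨(hlim z hz).prodMk_nhds (hlim y hy),
          .of_forall fun N => ⟨hmem N z, hmem N y⟩⟩
      exact (hB.continuousOn (z, y) ⟨hz, hy⟩).tendsto.comp h1

/-- Jacobi's identity for rank one perturbations of a Fredholm determinant. -/
theorem fredholmDet_bilinear_identity [MetricSpace X] [SecondCountableTopology X] [BorelSpace X]
    [SigmaFinite μ] (hw : IsWeight μ D w) {A : X → X → ℂ} (hA : IsCtsKernel D A)
    {e κ ra rb : X → ℂ} (he : IsCtsFun D e) (hκ : IsCtsFun D κ) (hra : IsCtsFun D ra)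
    (hrb : IsCtsFun D rb) {a b : ℂ} (hab : a ≠ b) :
    (fredholmDet μ w (fun z y => A z y + (a * e z - e z - κ z) * ra y) -
        fredholmDet μ w (fun z y => A z y + (-1 * e z) * ra y)) *
      fredholmDet μ w (fun z y => A z y + (-1 * e z) * rb y) -
    fredholmDet μ w (fun z y => A z y + (-1 * e z) * ra y) *
      (fredholmDet μ w (fun z y => A z y + (b * e z - e z - κ z) * rb y) -
        fredholmDet μ w (fun z y => A z y + (-1 * e z) * rb y)) =
    (b - a) * (fredholmDet μ w (fun z y => A z y + (-1 * e z) * ra y) *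
        fredholmDet μ w (fun z y => A z y + (-1 * e z) * rb y) -
      fredholmDet μ w A * fredholmDet μ w (fun z y => A z y +
        ((b - a)⁻¹ * (κ z - b * e z)) * ra y + ((b - a)⁻¹ * (a * e z - κ z)) * rb y)) := by
  classical
  obtain ⟨C, W, h⟩ := exists_tendsto_det hw
  have h0 := h _ hA
  have h1 := h _ (hA.add_mul (((he.const_mul a).sub he).sub hκ) hra)
  have h2 := h _ (hA.add_mul (((he.const_mul b).sub he).sub hκ) hrb)
  have h3 := h _ (hA.add_mul (he.const_mul (-1)) hra)
  have h4 := h _ (hA.add_mul (he.const_mul (-1)) hrb)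
  have h5 := h _ ((hA.add_mul ((hκ.sub (he.const_mul b)).const_mul (b - a)⁻¹) hra).add_mul
    (((he.const_mul a).sub hκ).const_mul (b - a)⁻¹) hrb)
  refine tendsto_nhds_unique (((h1.sub h3).mul h4).sub (h3.mul (h2.sub h4)))
    (Tendsto.congr (fun N => ?_) (((h3.mul h4).sub (h0.mul h5)).const_mul (b - a)))
  set m : Matrix (C N) (C N) ℂ := 1 + Matrix.of fun i j : C N => A i j * W N j with hm
  have hadd : ∀ c r : X → ℂ, (1 + Matrix.of fun i j : C N => (A i j + c i * r j) * W N j) =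
      m + Matrix.vecMulVec (fun i : C N => c i) (fun j : C N => r j * W N j) := by
    intro c r
    ext i j
    simp only [hm, Matrix.add_apply, Matrix.of_apply, Matrix.vecMulVec_apply]
    ring
  have hadd2 : ∀ c r d s : X → ℂ,
      (1 + Matrix.of fun i j : C N => (A i j + c i * r j + d i * s j) * W N j) =
      m + (Matrix.vecMulVec (fun i : C N => c i) (fun j : C N => r j * W N j) +
        Matrix.vecMulVec (fun i : C N => d i) (fun j : C N => s j * W N j)) := by
    intro c r d s
    ext i j
    simp only [hm, Matrix.add_apply, Matrix.of_apply, Matrix.vecMulVec_apply]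
    ring
  have hsub : ∀ r : X → ℂ, (1 + Matrix.of fun i j : C N => (A i j + -1 * e i * r j) * W N j) =
      m - Matrix.vecMulVec (fun i : C N => e i) (fun j : C N => r j * W N j) := by
    intro r
    ext i j
    simp only [hm, Matrix.add_apply, Matrix.sub_apply, Matrix.of_apply, Matrix.vecMulVec_apply]
    ring
  rw [hadd (fun z => a * e z - e z - κ z), hadd (fun z => b * e z - e z - κ z), hsub, hsub,
    hadd2 (fun z => (b - a)⁻¹ * (κ z - b * e z)) ra (fun z => (b - a)⁻¹ * (a * e z - κ z))]
  exact (Matrix.bilinear_det_identity m (fun i : C N => e i) (fun i : C N => κ i)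
    (fun j : C N => ra j * W N j) (fun j : C N => rb j * W N j) hab).symm

end Discretization

/-! ### The bilinear identity for the Cauchy kernel -/

section Cauchy

open DLData

/-- The factor `(a - k)/(a + k')` by which the elementary discrete (Miwa) shift with parameter `a`
changes the weight of a Fredholm determinant with the kernel `1/(k + k')`. -/
noncomputable def miwa (a : ℂ) (z : ℂ × ℂ) : ℂ := (a - z.1) / (a + z.2)

/-- The Fredholm determinant with the Cauchy kernel `1/(k + k')`. -/
noncomputable def cauchyDet (μ : Measure (ℂ × ℂ)) (w : ℂ × ℂ → ℂ) : ℂ :=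
  fredholmDet μ w fun z y => Omega z.1 y.2

/-- The Fredholm determinant with the kernel `1/(k + k') + 1`. Its difference to `cauchyDet` is the
derivative of the latter under `w ↦ exp (x (k + k')) w`. -/
noncomputable def cauchyDetOne (μ : Measure (ℂ × ℂ)) (w : ℂ × ℂ → ℂ) : ℂ :=
  fredholmDet μ w fun z y => Omega z.1 y.2 + 1

variable {μ : Measure (ℂ × ℂ)} {D : Set (ℂ × ℂ)} {w : ℂ × ℂ → ℂ} {a b : ℂ} {δ : ℝ}

theorem measurable_Omega : Measurable fun p : (ℂ × ℂ) × (ℂ × ℂ) => Omega p.1.1 p.2.2 := by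
  unfold Omega
  exact measurable_const.div (by fun_prop)

theorem norm_Omega_le (hδ : 0 < δ) (hD : ∀ z ∈ D, ∀ y ∈ D, δ ≤ ‖z.1 + y.2‖) :
    ∀ z ∈ D, ∀ y ∈ D, ‖Omega z.1 y.2‖ ≤ 1 / δ := by
  intro z hz y hy
  rw [Omega, norm_div, norm_one]
  exact one_div_le_one_div_of_le hδ (hD z hz y hy)

/-- The bilinear equation
`∂g_a · g_b - g_a · ∂g_b = (b - a) (g_a g_b - g g_{ab})`, where `g` is the determinant with weight
`w`, an index `a` stands for the Miwa shift `w ↦ w (a - k)/(a + k')`, and `∂g` is written as the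
difference of two determinants. Each of the shifted kernels is, up to a gauge, a perturbation of
`1/(k + k')` of rank one or two, for instance
`(a - k)/(a + k') · 1/(k + k') = 1/(k + k') - 1/(a + k')`. -/
theorem cauchyDet_bilinear [SigmaFinite μ] (hδ : 0 < δ) (hD : ∀ z ∈ D, ∀ y ∈ D, δ ≤ ‖z.1 + y.2‖)
    (ha : ∀ z ∈ D, a + z.2 ≠ 0) (hb : ∀ z ∈ D, b + z.2 ≠ 0) (hw : ∀ z, z ∉ D → w z = 0)
    (hint : Integrable (fun z => w z *
      (((1 + ‖z.1‖ : ℝ) : ℂ) * ((1 + ‖(a + z.2)⁻¹‖ + ‖(b + z.2)⁻¹‖ : ℝ) : ℂ))) μ) :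
    (cauchyDetOne μ (fun z => w z * miwa a z) - cauchyDet μ (fun z => w z * miwa a z)) *
      cauchyDet μ (fun z => w z * miwa b z) -
    cauchyDet μ (fun z => w z * miwa a z) *
      (cauchyDetOne μ (fun z => w z * miwa b z) - cauchyDet μ (fun z => w z * miwa b z)) =
    (b - a) * (cauchyDet μ (fun z => w z * miwa a z) * cauchyDet μ (fun z => w z * miwa b z) -
      cauchyDet μ w * cauchyDet μ (fun z => w z * miwa a z * miwa b z)) := by
  rcases eq_or_ne a b with rfl | hab
  · ring
  have hba : b - a ≠ 0 := sub_ne_zero.2 hab.symm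
  set α : ℂ × ℂ → ℂ := fun z => ((1 + ‖z.1‖ : ℝ) : ℂ) with hα
  set β : ℂ × ℂ → ℂ := fun z => ((1 + ‖(a + z.2)⁻¹‖ + ‖(b + z.2)⁻¹‖ : ℝ) : ℂ) with hβ
  have hα0 : ∀ z, α z ≠ 0 := fun z => Complex.ofReal_ne_zero.2 (by positivity)
  have hβ0 : ∀ z, β z ≠ 0 := fun z => Complex.ofReal_ne_zero.2 (by positivity)
  have hαn : ∀ z, ‖α z‖ = 1 + ‖z.1‖ := fun z => Complex.norm_of_nonneg (by positivity)
  have hβn : ∀ z, ‖β z‖ = 1 + ‖(a + z.2)⁻¹‖ + ‖(b + z.2)⁻¹‖ := fun z =>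
    Complex.norm_of_nonneg (by positivity)
  have hαc : Continuous α := by fun_prop
  have hβm : Measurable β := by
    refine Complex.measurable_ofReal.comp ?_
    exact ((measurable_const.add (Measurable.norm (by fun_prop))).add
      (Measurable.norm (by fun_prop)))
  have hac : ContinuousOn (fun z : ℂ × ℂ => (a + z.2)⁻¹) D :=
    ContinuousOn.inv₀ (by fun_prop) ha
  have hbc : ContinuousOn (fun z : ℂ × ℂ => (b + z.2)⁻¹) D :=
    ContinuousOn.inv₀ (by fun_prop) hb
  have hβc : ContinuousOn β D :=
    Complex.continuous_ofReal.comp_continuousOn ((continuousOn_const.add hac.norm).add hbc.norm)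
  set w' : ℂ × ℂ → ℂ := fun z => w z * (α z * β z) with hw'
  set A : ℂ × ℂ → ℂ × ℂ → ℂ := fun z y => (α z)⁻¹ * Omega z.1 y.2 * (β y)⁻¹ with hA
  set e : ℂ × ℂ → ℂ := fun z => (α z)⁻¹ with he
  set κ : ℂ × ℂ → ℂ := fun z => z.1 * (α z)⁻¹ with hκ
  set ra : ℂ × ℂ → ℂ := fun y => (a + y.2)⁻¹ * (β y)⁻¹ with hra
  set rb : ℂ × ℂ → ℂ := fun y => (b + y.2)⁻¹ * (β y)⁻¹ with hrb
  have hwD : IsWeight μ D w' := ⟨hint, fun z hz => by simp [hw', hw z hz]⟩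
  have heF : IsCtsFun D e := by
    refine ⟨hαc.measurable.inv, ⟨1, fun z _ => ?_⟩, (hαc.inv₀ hα0).continuousOn⟩
    rw [he, norm_inv, hαn]
    exact inv_le_one_of_one_le₀ (by linarith [norm_nonneg z.1])
  have hκF : IsCtsFun D κ := by
    refine ⟨measurable_fst.mul hαc.measurable.inv, ⟨1, fun z _ => ?_⟩,
      (continuous_fst.mul (hαc.inv₀ hα0)).continuousOn⟩
    rw [hκ, norm_mul, norm_inv, hαn, ← div_eq_mul_inv]
    exact (div_le_one (by positivity)).2 (by linarith)
  have hraF : IsCtsFun D ra := by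
    refine ⟨Measurable.mul (by fun_prop) hβm.inv, ⟨1, fun z _ => ?_⟩,
      hac.mul (hβc.inv₀ fun z _ => hβ0 z)⟩
    rw [hra, norm_mul, norm_inv (β z), hβn, ← div_eq_mul_inv]
    exact (div_le_one (by positivity)).2 (by linarith [norm_nonneg (b + z.2)⁻¹])
  have hrbF : IsCtsFun D rb := by
    refine ⟨Measurable.mul (by fun_prop) hβm.inv, ⟨1, fun z _ => ?_⟩,
      hbc.mul (hβc.inv₀ fun z _ => hβ0 z)⟩
    rw [hrb, norm_mul, norm_inv (β z), hβn, ← div_eq_mul_inv]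
    exact (div_le_one (by positivity)).2 (by linarith [norm_nonneg (a + z.2)⁻¹])
  have hsum : ∀ z ∈ D, ∀ y ∈ D, z.1 + y.2 ≠ 0 := fun z hz y hy =>
    norm_pos_iff.1 (hδ.trans_le (hD z hz y hy))
  have hAK : IsCtsKernel D A := by
    refine ⟨((hαc.measurable.inv.comp measurable_fst).mul measurable_Omega).mul
      (hβm.inv.comp measurable_snd), ⟨1 * (1 / δ) * 1, fun z hz y hy => ?_⟩, ?_⟩
    · rw [hA, norm_mul, norm_mul]
      have h1 : ‖(α z)⁻¹‖ ≤ 1 := by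
        rw [norm_inv, hαn]
        exact inv_le_one_of_one_le₀ (by linarith [norm_nonneg z.1])
      have h2 : ‖(β y)⁻¹‖ ≤ 1 := by
        rw [norm_inv, hβn]
        exact inv_le_one_of_one_le₀ (by
          linarith [norm_nonneg (a + y.2)⁻¹, norm_nonneg (b + y.2)⁻¹])
      have h3 := norm_Omega_le hδ hD z hz y hy
      gcongr
    · refine ContinuousOn.mul (ContinuousOn.mul ?_ ?_) ?_
      · exact ((hαc.inv₀ hα0).comp continuous_fst).continuousOn
      · simp only [Omega]
        exact ContinuousOn.div continuousOn_const (by fun_prop) fun p hp => hsum _ hp.1 _ hp.2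
      · exact (hβc.inv₀ fun z _ => hβ0 z).comp continuous_snd.continuousOn fun p hp => hp.2
  have key := fredholmDet_bilinear_identity hwD hAK heF hκF hraF hrbF hab
  have hwa : ∀ c : ℂ, ∀ z, z ∉ D → w z * miwa c z = 0 := fun c z hz => by rw [hw z hz, zero_mul]
  have h0 : cauchyDet μ w = fredholmDet μ w' A :=
    fredholmDet_congr_gauge (D := D) (fun z => (α z)⁻¹) (fun z => (β z)⁻¹) hw hwD.eq_zero
      (fun z _ y _ => rfl) fun z _ => by
        have := hα0 z; have := hβ0 z
        simp only [hw']; field_simp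
  have h1 : ∀ c : ℂ, (∀ z ∈ D, c + z.2 ≠ 0) →
      cauchyDet μ (fun z => w z * miwa c z) =
        fredholmDet μ w' (fun z y => A z y + (-1 * e z) * ((c + y.2)⁻¹ * (β y)⁻¹)) := by
    intro c hc
    refine fredholmDet_congr_gauge (D := D) (fun z => (c - z.1) * (α z)⁻¹)
      (fun z => (c + z.2)⁻¹ * (β z)⁻¹) (hwa c) hwD.eq_zero (fun z hz y hy => ?_) fun z hz => ?_
    · have := hα0 z; have := hβ0 y; have := hsum z hz y hy; have := hc y hy
      simp only [hA, he, Omega]; field_simp; ring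
    · have := hα0 z; have := hβ0 z; have := hc z hz
      simp only [hw', miwa]; field_simp
  have h2 : ∀ c : ℂ, (∀ z ∈ D, c + z.2 ≠ 0) →
      cauchyDetOne μ (fun z => w z * miwa c z) =
        fredholmDet μ w' (fun z y => A z y + (c * e z - e z - κ z) *
          ((c + y.2)⁻¹ * (β y)⁻¹)) := by
    intro c hc
    refine fredholmDet_congr_gauge (D := D) (fun z => (c - z.1) * (α z)⁻¹)
      (fun z => (c + z.2)⁻¹ * (β z)⁻¹) (hwa c) hwD.eq_zero (fun z hz y hy => ?_) fun z hz => ?_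
    · have := hα0 z; have := hβ0 y; have := hsum z hz y hy; have := hc y hy
      simp only [hA, he, hκ, Omega]; field_simp; ring
    · have := hα0 z; have := hβ0 z; have := hc z hz
      simp only [hw', miwa]; field_simp
  have h3 : cauchyDet μ (fun z => w z * miwa a z * miwa b z) =
      fredholmDet μ w' (fun z y => A z y + ((b - a)⁻¹ * (κ z - b * e z)) * ra y +
        ((b - a)⁻¹ * (a * e z - κ z)) * rb y) := by
    refine fredholmDet_congr_gauge (D := D) (fun z => (a - z.1) * (b - z.1) * (α z)⁻¹)
      (fun z => (a + z.2)⁻¹ * (b + z.2)⁻¹ * (β z)⁻¹) (fun z hz => by rw [hwa a z hz, zero_mul])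
      hwD.eq_zero (fun z hz y hy => ?_) fun z hz => ?_
    · have := hα0 z; have := hβ0 y; have := hsum z hz y hy; have := ha y hy; have := hb y hy
      simp only [hA, he, hκ, hra, hrb, Omega]; field_simp; ring
    · have := hα0 z; have := hβ0 z; have := ha z hz; have := hb z hz
      simp only [hw', miwa]; field_simp
  rw [h0, h3, h1 a ha, h1 b hb, h2 a ha, h2 b hb]
  exact key

end Cauchy

/-! ### Differentiation along exponential flows of the weight -/

section Flow

open Filter Topology

variable {X : Type*} [MeasurableSpace X]

/-- The Fredholm series with the factor `(∑_a κ (z_a)) ^ j` under the integrals, that is, the `j`-th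
derivative of the Fredholm determinant along `w ↦ exp (x κ) w`. -/
noncomputable def fredholmMoment (μ : Measure X) (κ : X → ℂ) (j : ℕ) (w : X → ℂ)
    (A : X → X → ℂ) : ℂ :=
  ∑' r : ℕ, ((r.factorial : ℂ))⁻¹ * ∫ z : Fin r → X, (∑ a, κ (z a)) ^ j *
    ((Matrix.of fun a b => A (z a) (z b)).det * ∏ a, w (z a)) ∂Measure.pi fun _ => μ

variable {μ : Measure X} {D : Set X} {κ w₀ : X → ℂ} {A : X → X → ℂ} {M : ℝ}

theorem fredholmMoment_zero (μ : Measure X) (κ w : X → ℂ) (A : X → X → ℂ) :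
    fredholmMoment μ κ 0 w A = fredholmDet μ w A := by
  simp [fredholmMoment, fredholmDet]

theorem norm_sum_le_prod_one_add {r : ℕ} (v : Fin r → ℂ) : ‖∑ a, v a‖ ≤ ∏ a, (1 + ‖v a‖) := by
  have h : ∀ s : Finset (Fin r), 1 + ∑ a ∈ s, ‖v a‖ ≤ ∏ a ∈ s, (1 + ‖v a‖) := by
    intro s
    induction s using Finset.induction_on with
    | empty => simp
    | insert a s ha ih =>
      rw [Finset.sum_insert ha, Finset.prod_insert ha]
      have h1 : 0 ≤ ∑ a ∈ s, ‖v a‖ := Finset.sum_nonneg fun _ _ => norm_nonneg _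
      nlinarith [norm_nonneg (v a)]
  linarith [norm_sum_le Finset.univ v, h Finset.univ]

/-- The function `y ↦ |exp (c y)|` is monotone or antitone, so on an interval it is at most the sum
of its values at the end points. -/
theorem norm_cexp_mul_le {s t y : ℝ} (hs : s ≤ y) (ht : y ≤ t) (c : ℂ) :
    ‖Complex.exp (c * y)‖ ≤ ‖Complex.exp (c * s)‖ + ‖Complex.exp (c * t)‖ := by
  simp only [Complex.norm_exp, Complex.re_mul_ofReal]
  rcases le_total 0 c.re with h | h
  · have := Real.exp_le_exp.2 (mul_le_mul_of_nonneg_left ht h)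
    linarith [Real.exp_pos (c.re * s)]
  · have := Real.exp_le_exp.2 (mul_le_mul_of_nonpos_left hs h)
    linarith [Real.exp_pos (c.re * t)]

/-- Along the flow `w ↦ exp (x κ) w` of the weight, the Fredholm series may be differentiated
term by term. -/
theorem hasDerivAt_fredholmMoment [SigmaFinite μ] {I : Set ℝ} (hI : IsOpen I)
    (hκ : Measurable κ) (hA : IsBddKernel D M A) (hw : ∀ z, z ∉ D → w₀ z = 0)
    (hint : ∀ x ∈ I, ∀ N : ℕ, Integrable
      (fun z => ((1 + ‖κ z‖ : ℝ) : ℂ) ^ N * (Complex.exp (κ z * x) * w₀ z)) μ)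
    (j : ℕ) {x : ℝ} (hx : x ∈ I) :
    HasDerivAt (fun y : ℝ => fredholmMoment μ κ j (fun z => Complex.exp (κ z * y) * w₀ z) A)
      (fredholmMoment μ κ (j + 1) (fun z => Complex.exp (κ z * x) * w₀ z) A) x := by
  obtain ⟨ε, hε, hεI⟩ := Metric.nhds_basis_closedBall.mem_iff.1 (hI.mem_nhds hx)
  have hs : x - ε ∈ I := hεI (by simp [abs_of_pos hε])
  have ht : x + ε ∈ I := hεI (by simp [abs_of_pos hε])
  have hbI : ∀ y ∈ Metric.ball x ε, y ∈ I := fun y hy => hεI (Metric.ball_subset_closedBall hy)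
  set w : ℝ → X → ℂ := fun y z => Complex.exp (κ z * y) * w₀ z with hwdef
  have hwt : ∀ y ∈ I, IsWeight μ D (w y) := fun y hy =>
    ⟨by simpa using hint y hy 0, fun z hz => by simp [hwdef, hw z hz]⟩
  -- a common integrable majorant of all weights near `x`, with room for `j + 1` factors `κ`
  set H : X → ℝ := fun z => (1 + ‖κ z‖) ^ (j + 1) * (‖w (x - ε) z‖ + ‖w (x + ε) z‖) with hH
  have hHint : Integrable H μ := by
    have h1 := ((hint _ hs (j + 1)).norm.add (hint _ ht (j + 1)).norm)
    refine h1.congr (.of_forall fun z => ?_)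
    simp only [Pi.add_apply, norm_mul, norm_pow, hH]
    rw [Complex.norm_of_nonneg (by positivity)]
    simp only [hwdef, norm_mul]
    ring
  have hH0 : ∀ z, 0 ≤ H z := fun z => by positivity
  have hwH : ∀ i ≤ j + 1, ∀ y ∈ Metric.ball x ε, ∀ z, (1 + ‖κ z‖) ^ i * ‖w y z‖ ≤ H z := by
    intro i hi y hy z
    rw [Metric.mem_ball, Real.dist_eq, abs_lt] at hy
    have h1 : ‖w y z‖ ≤ ‖w (x - ε) z‖ + ‖w (x + ε) z‖ := by
      simp only [hwdef, norm_mul]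
      rw [← add_mul]
      gcongr
      exact norm_cexp_mul_le (by linarith) (by linarith) _
    have h2 : (1 + ‖κ z‖) ^ i ≤ (1 + ‖κ z‖) ^ (j + 1) :=
      pow_le_pow_right₀ (by linarith [norm_nonneg (κ z)]) hi
    simp only [hH]
    gcongr
  have hbd : ∀ i ≤ j + 1, ∀ y ∈ Metric.ball x ε, ∀ (r : ℕ) (z : Fin r → X),
      ‖(∑ a, κ (z a)) ^ i * ((Matrix.of fun a b => A (z a) (z b)).det * ∏ a, w y (z a))‖ ≤
        (M * √r) ^ r * ∏ a, H (z a) := by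
    intro i hi y hy r z
    have h1 := norm_det_mul_prod_le (hwt y (hbI y hy)) hA.bound z
    have h2 : ‖∑ a, κ (z a)‖ ^ i ≤ ∏ a, (1 + ‖κ (z a)‖) ^ i := by
      rw [Finset.prod_pow]
      exact pow_le_pow_left₀ (norm_nonneg _) (norm_sum_le_prod_one_add _) i
    by_cases hz : ∀ a, z a ∈ D
    · have hM : 0 ≤ (M * √r) ^ r := (norm_nonneg _).trans
        (Matrix.norm_det_le_of_norm_le (Matrix.of fun a b => A (z a) (z b))
          fun a b => hA.bound _ (hz a) _ (hz b))
      calc _ ≤ (∏ a, (1 + ‖κ (z a)‖) ^ i) * ((M * √r) ^ r * ∏ a, ‖w y (z a)‖) := by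
            rw [norm_mul, norm_pow]
            exact mul_le_mul h2 h1 (norm_nonneg _)
              (Finset.prod_nonneg fun a _ => by positivity)
        _ = (M * √r) ^ r * ∏ a, ((1 + ‖κ (z a)‖) ^ i * ‖w y (z a)‖) := by
            rw [Finset.prod_mul_distrib]; ring
        _ ≤ _ := mul_le_mul_of_nonneg_left
            (Finset.prod_le_prod (fun a _ => by positivity) fun a _ => hwH i hi y hy _) hM
    · have hz' := hz
      push Not at hz'
      obtain ⟨a, ha⟩ := hz'
      have h0 : H (z a) = 0 := by simp [hH, hwdef, hw _ ha]
      rw [(hwt y (hbI y hy)).prod_eq_zero hz, Finset.prod_eq_zero (Finset.mem_univ a) h0]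
      simp
  have hHr : ∀ r : ℕ, Integrable (fun z : Fin r → X => (M * √r) ^ r * ∏ a, H (z a))
      (Measure.pi fun _ => μ) := fun r =>
    (Integrable.fintype_prod (f := fun _ => H) fun _ => hHint).const_mul _
  have hmeas : ∀ i, ∀ y ∈ I, ∀ r : ℕ, AEStronglyMeasurable (fun z : Fin r → X =>
      (∑ a, κ (z a)) ^ i * ((Matrix.of fun a b => A (z a) (z b)).det * ∏ a, w y (z a)))
      (Measure.pi fun _ => μ) := by
    intro i y hy r
    refine AEStronglyMeasurable.mul (Measurable.aestronglyMeasurable ?_)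
      (integrable_det_mul_prod (hwt y hy) hA r).aestronglyMeasurable
    exact (Finset.measurable_fun_sum _ fun a _ => hκ.comp (measurable_pi_apply a)).pow_const i
  have hnorm : ∀ i ≤ j + 1, ∀ y ∈ Metric.ball x ε, ∀ r : ℕ,
      ‖((r.factorial : ℂ))⁻¹ * ∫ z : Fin r → X, (∑ a, κ (z a)) ^ i *
        ((Matrix.of fun a b => A (z a) (z b)).det * ∏ a, w y (z a)) ∂Measure.pi fun _ => μ‖ ≤
      ((r.factorial : ℝ))⁻¹ * ((M * ∫ z, H z ∂μ) * √r) ^ r := by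
    intro i hi y hy r
    rw [norm_mul, norm_inv, Complex.norm_natCast]
    gcongr
    refine (norm_integral_le_of_norm_le (hHr r) (.of_forall (hbd i hi y hy r))).trans
      (le_of_eq ?_)
    rw [integral_const_mul, integral_fintype_prod_eq_prod (fun _ : Fin r => H)]
    simp only [Finset.prod_const, Finset.card_univ, Fintype.card_fin]
    rw [← mul_pow]
    ring
  have hxb : x ∈ Metric.ball x ε := Metric.mem_ball_self hε
  refine hasDerivAt_tsum_of_isPreconnected (summable_hadamard_bound (M * ∫ z, H z ∂μ))
    Metric.isOpen_ball (convex_ball x ε).isPreconnected (fun r y hy => ?_)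
    (fun r y hy => hnorm (j + 1) le_rfl y hy r) hxb
    (.of_norm_bounded (summable_hadamard_bound _) (hnorm j (Nat.le_succ j) x hxb)) hxb
  refine HasDerivAt.const_mul _ ?_
  have hnhds : Metric.ball x ε ∈ 𝓝 y := Metric.isOpen_ball.mem_nhds hy
  refine (hasDerivAt_integral_of_dominated_loc_of_deriv_le hnhds
    (.mono (eventually_mem_set.2 hnhds) fun t ht => hmeas j t (hbI t ht) r)
    ((hHr r).mono' (hmeas j y (hbI y hy) r) (.of_forall (hbd j (Nat.le_succ j) y hy r)))
    (hmeas (j + 1) y (hbI y hy) r)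
    (.of_forall fun z t ht => hbd (j + 1) le_rfl t ht r z) (hHr r)
    (.of_forall fun z t _ => ?_)).2
  have hprod : ∀ t : ℝ, ∏ a, w t (z a) = Complex.exp ((∑ a, κ (z a)) * t) * ∏ a, w₀ (z a) := by
    intro t
    rw [Finset.sum_mul, Complex.exp_sum, ← Finset.prod_mul_distrib]
  simp only [hprod]
  set c := ∑ a, κ (z a)
  have hexp : HasDerivAt (fun t : ℝ => Complex.exp (c * t)) (Complex.exp (c * t) * (c * 1)) t :=
    ((Complex.ofRealCLM.hasDerivAt (x := t)).const_mul c).cexp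
  refine (((hexp.mul_const _).const_mul _).const_mul _).congr_deriv ?_
  ring

end Flow

section CauchyFlow

open DLData

variable {μ : Measure (ℂ × ℂ)} {D : Set (ℂ × ℂ)} {w : ℂ × ℂ → ℂ} {δ : ℝ}

theorem fredholmMoment_one_eq [SigmaFinite μ] (hδ : 0 < δ)
    (hD : ∀ z ∈ D, ∀ y ∈ D, δ ≤ ‖z.1 + y.2‖) (hw : IsWeight μ D w) :
    fredholmMoment μ (fun z => z.1 + z.2) 1 w (fun z y => Omega z.1 y.2) =
      cauchyDetOne μ w - cauchyDet μ w := by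
  have h1 := norm_Omega_le hδ hD
  have h2 : ∀ z ∈ D, ∀ y ∈ D, ‖Omega z.1 y.2 + 1‖ ≤ 1 / δ + 1 := fun z hz y hy =>
    (norm_add_le _ _).trans (add_le_add (h1 z hz y hy) (by simp))
  rw [cauchyDetOne, cauchyDet, fredholmDet, fredholmDet, fredholmMoment,
    ← (summable_fredholm hw h2).tsum_sub (summable_fredholm hw h1)]
  congr 1
  ext r
  rw [← mul_sub, ← integral_sub
    (integrable_det_mul_prod hw ⟨measurable_Omega.add measurable_const, h2⟩ r)
    (integrable_det_mul_prod hw ⟨measurable_Omega, h1⟩ r)]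
  congr 2
  ext z
  by_cases hz : ∀ a, z a ∈ D
  · have h3 := Matrix.det_add_one_of_cauchy (Matrix.of fun a b : Fin r => Omega (z a).1 (z b).2)
      (fun a => (z a).1) (fun a => (z a).2) fun a b => by
        have : (z a).1 + (z b).2 ≠ 0 :=
          norm_pos_iff.1 (hδ.trans_le (hD _ (hz a) _ (hz b)))
        rw [Matrix.of_apply, Omega, mul_one_div_cancel this]
    have h4 : (Matrix.of fun a b : Fin r => Omega (z a).1 (z b).2 + 1) =
        (Matrix.of fun a b : Fin r => Omega (z a).1 (z b).2) + Matrix.of fun _ _ => 1 := by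
      ext a b; rfl
    rw [h4, h3]
    ring
  · rw [hw.prod_eq_zero hz]
    ring

end CauchyFlow

/-! ### First minors and the linear integral equation -/

section Minors

open Filter Topology

variable {X : Type*} [MeasurableSpace X] {μ : Measure X} {D : Set X} {w : X → ℂ}
  {A : X → X → ℂ} {M : ℝ}

/-- The row of first Fredholm minors belonging to the right-hand side `1`, that is, the solution of
the transposed integral equation multiplied by the Fredholm determinant: the minor at `l` is the
determinant with the kernel `A z y - A z l`. -/
noncomputable def fredholmMinor (μ : Measure X) (w : X → ℂ) (A : X → X → ℂ) (l : X) : ℂ :=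
  fredholmDet μ w fun z y => A z y - A z l

variable [SigmaFinite μ]

theorem aestronglyMeasurable_minor_integrand (hw : IsWeight μ D w)
    (hA : Measurable fun p : X × X => A p.1 p.2) (r : ℕ) :
    AEStronglyMeasurable (fun p : X × (Fin r → X) =>
      (Matrix.of fun a b => A (p.2 a) (p.2 b) - A (p.2 a) p.1).det * ∏ a, w (p.2 a))
      (μ.prod (Measure.pi fun _ => μ)) := by
  refine AEStronglyMeasurable.mul (Measurable.aestronglyMeasurable ?_)
    (hw.aestronglyMeasurable_prod r).comp_snd
  simp only [Matrix.det_apply, Matrix.of_apply]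
  refine Finset.measurable_fun_sum _ fun σ _ => ?_
  refine Measurable.const_smul (Finset.measurable_fun_prod _ fun i _ => Measurable.sub ?_ ?_) _
  · exact hA.comp (f := fun p : X × (Fin r → X) => (p.2 (σ i), p.2 i)) (by fun_prop)
  · exact hA.comp (f := fun p : X × (Fin r → X) => (p.2 (σ i), p.1)) (by fun_prop)

theorem IsBddKernel.bound_sub (hA : IsBddKernel D M A) {l : X} (hl : l ∈ D) :
    ∀ z ∈ D, ∀ y ∈ D, ‖A z y - A z l‖ ≤ M + M := fun z hz y hy =>
  (norm_sub_le _ _).trans (add_le_add (hA.bound z hz y hy) (hA.bound z hz l hl))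

theorem aestronglyMeasurable_fredholmMinor_mul (hw : IsWeight μ D w) (hA : IsBddKernel D M A)
    {q : X → ℂ} (hq : AEStronglyMeasurable q μ) (hq0 : ∀ z, z ∉ D → q z = 0) :
    AEStronglyMeasurable (fun l => fredholmMinor μ w A l * q l) μ := by
  refine aestronglyMeasurable_of_tendsto_ae atTop
    (f := fun n l => (∑ r ∈ Finset.range n, ((r.factorial : ℂ))⁻¹ * ∫ z : Fin r → X,
      (Matrix.of fun a b => A (z a) (z b) - A (z a) l).det * ∏ a, w (z a)
        ∂Measure.pi fun _ => μ) * q l) (fun n => ?_) (.of_forall fun l => ?_)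
  · refine AEStronglyMeasurable.mul (Finset.aestronglyMeasurable_fun_sum _ fun r _ => ?_) hq
    have h := (aestronglyMeasurable_minor_integrand hw hA.measurable r).integral_prod_right'
    exact h.const_mul _
  · by_cases hl : l ∈ D
    · have h := hasSum_fredholmDet hw (hA.bound_sub hl)
      exact h.tendsto_sum_nat.mul_const _
    · simp only [hq0 l hl, mul_zero]
      exact tendsto_const_nhds

theorem integrable_fredholmMinor_mul (hw : IsWeight μ D w) (hA : IsBddKernel D M A)
    {q : X → ℂ} (hq : Integrable q μ) (hq0 : ∀ z, z ∉ D → q z = 0) :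
    Integrable (fun l => fredholmMinor μ w A l * q l) μ := by
  obtain ⟨Y, hY⟩ : ∃ Y : ℝ, ∀ l ∈ D, ‖fredholmMinor μ w A l‖ ≤ Y :=
    ⟨_, fun l hl => norm_fredholmDet_le hw (hA.bound_sub hl)⟩
  refine (hq.norm.const_mul Y).mono'
    (aestronglyMeasurable_fredholmMinor_mul hw hA hq.aestronglyMeasurable hq0)
    (.of_forall fun l => ?_)
  by_cases hl : l ∈ D
  · rw [norm_mul]
    exact mul_le_mul_of_nonneg_right (hY l hl) (norm_nonneg _)
  · simp [hq0 l hl]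

/-- A perturbation of the kernel by a function of the first variable only changes the Fredholm
determinant by the pairing with the first minors. In each order the difference is the sum over `i`
of `c (z i)` times the determinant whose `i`-th row consists of ones, and all these summands have
the same integral. -/
theorem fredholmDet_add_sub (hw : IsWeight μ D w) (hA : IsBddKernel D M A) {c : X → ℂ} {P : ℝ}
    (hc : Measurable c) (hP : ∀ z ∈ D, ‖c z‖ ≤ P) :
    fredholmDet μ w (fun z y => A z y + c z) - fredholmDet μ w A =
      ∫ l, fredholmMinor μ w A l * (w l * c l) ∂μ := by
  have hq : Integrable (fun l => w l * c l) μ := by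
    refine (hw.integrable.norm.const_mul P).mono'
      (hw.integrable.aestronglyMeasurable.mul hc.aestronglyMeasurable) (.of_forall fun l => ?_)
    by_cases hl : l ∈ D
    · rw [norm_mul, mul_comm]
      gcongr
      exact hP l hl
    · simp [hw.eq_zero l hl]
  have hq0 : ∀ z, z ∉ D → w z * c z = 0 := fun z hz => by rw [hw.eq_zero z hz, zero_mul]
  have hAc : IsBddKernel D (M + P) (fun z y => A z y + c z) :=
    ⟨hA.measurable.add (hc.comp measurable_fst), fun z hz y hy =>
      (norm_add_le _ _).trans (add_le_add (hA.bound z hz y hy) (hP z hz))⟩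
  set G : (r : ℕ) → X × (Fin r → X) → ℂ := fun r p => (w p.1 * c p.1) *
    ((Matrix.of fun a b => A (p.2 a) (p.2 b) - A (p.2 a) p.1).det * ∏ a, w (p.2 a)) with hG
  have hGbd : ∀ r p, ‖G r p‖ ≤ ‖w p.1 * c p.1‖ *
      (((M + M) * √r) ^ r * ∏ a, ‖w (p.2 a)‖) := by
    intro r p
    rw [hG, norm_mul]
    by_cases hl : p.1 ∈ D
    · gcongr
      exact norm_det_mul_prod_le hw (hA.bound_sub hl) p.2
    · simp [hq0 _ hl]
  have hGint : ∀ r, Integrable (G r) (μ.prod (Measure.pi fun _ => μ)) := fun r =>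
    (hq.norm.mul_prod ((hw.integrable_prod_norm r).const_mul _)).mono'
      (hq.aestronglyMeasurable.comp_fst.mul
        (aestronglyMeasurable_minor_integrand hw hA.measurable r))
      (.of_forall (hGbd r))
  -- the terms of order `r + 1`
  have hterm : ∀ r : ℕ,
      (((r + 1).factorial : ℂ))⁻¹ * (∫ z : Fin (r + 1) → X,
        (Matrix.of fun a b => A (z a) (z b) + c (z a)).det * ∏ a, w (z a)
          ∂Measure.pi fun _ => μ) -
      (((r + 1).factorial : ℂ))⁻¹ * (∫ z : Fin (r + 1) → X,
        (Matrix.of fun a b => A (z a) (z b)).det * ∏ a, w (z a) ∂Measure.pi fun _ => μ) =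
      ∫ l, (((r.factorial : ℂ))⁻¹ * ∫ z : Fin r → X,
        (Matrix.of fun a b => A (z a) (z b) - A (z a) l).det * ∏ a, w (z a)
          ∂Measure.pi fun _ => μ) * (w l * c l) ∂μ := by
    intro r
    have hpt : ∀ z : Fin (r + 1) → X,
        (Matrix.of fun a b => A (z a) (z b) + c (z a)).det * ∏ a, w (z a) -
          (Matrix.of fun a b => A (z a) (z b)).det * ∏ a, w (z a) =
        ∑ i, G r (MeasurableEquiv.piFinSuccAbove (fun _ => X) i z) := by
      intro z
      have h1 : (Matrix.of fun a b => A (z a) (z b) + c (z a)) =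
          (Matrix.of fun a b => A (z a) (z b)) +
            Matrix.vecMulVec (fun a => c (z a)) (fun _ => 1) := by
        ext a b
        simp [Matrix.vecMulVec_apply]
      rw [h1, Matrix.det_add_vecMulVec_eq_sum, ← sub_mul, add_sub_cancel_left, Finset.sum_mul]
      refine Finset.sum_congr rfl fun i _ => ?_
      rw [Matrix.det_updateRow_one, Fin.prod_univ_succAbove _ i]
      simp only [hG, MeasurableEquiv.piFinSuccAbove_apply, Fin.insertNthEquiv_symm_apply,
        Matrix.of_apply, Fin.removeNth]
      ring
    have hmp : ∀ i : Fin (r + 1), MeasurePreserving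
        (MeasurableEquiv.piFinSuccAbove (fun _ => X) i) (Measure.pi fun _ => μ)
        (μ.prod (Measure.pi fun _ => μ)) := fun i =>
      measurePreserving_piFinSuccAbove (fun _ : Fin (r + 1) => μ) i
    rw [← mul_sub, ← integral_sub (integrable_det_mul_prod hw hAc _)
      (integrable_det_mul_prod hw hA _)]
    simp_rw [hpt]
    have hGi : ∀ i : Fin (r + 1), Integrable (fun z =>
        G r (MeasurableEquiv.piFinSuccAbove (fun _ => X) i z)) (Measure.pi fun _ => μ) := fun i =>
      ((hmp i).integrable_comp_emb (MeasurableEquiv.measurableEmbedding _)).2 (hGint r)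
    rw [integral_finsetSum _ fun i _ => hGi i]
    have hi : ∀ i : Fin (r + 1), ∫ z, G r (MeasurableEquiv.piFinSuccAbove (fun _ => X) i z)
        ∂(Measure.pi fun _ => μ) = ∫ p, G r p ∂(μ.prod (Measure.pi fun _ => μ)) :=
      fun i => (hmp i).integral_comp' (G r)
    simp_rw [hi]
    rw [Finset.sum_const, Finset.card_univ, Fintype.card_fin, integral_prod _ (hGint r),
      nsmul_eq_mul, ← mul_assoc, Nat.factorial_succ, ← integral_const_mul]
    congr 1
    ext l
    simp only [hG]
    rw [integral_const_mul]
    have : (r.factorial : ℂ) ≠ 0 := by exact_mod_cast r.factorial_ne_zero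
    have : ((r : ℂ) + 1) ≠ 0 := by exact_mod_cast r.succ_ne_zero
    push_cast
    field_simp
  set g : ℕ → X → ℂ := fun r l => (((r.factorial : ℂ))⁻¹ * ∫ z : Fin r → X,
    (Matrix.of fun a b => A (z a) (z b) - A (z a) l).det * ∏ a, w (z a)
      ∂Measure.pi fun _ => μ) * (w l * c l) with hg
  have hgint : ∀ r, Integrable (g r) μ := fun r => by
    have := (hGint r).integral_prod_left.const_mul ((r.factorial : ℂ))⁻¹
    refine this.congr (.of_forall fun l => ?_)
    simp only [hG, hg]
    rw [integral_const_mul]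
    ring
  have hgbd : ∀ r l, ‖g r l‖ ≤ ((r.factorial : ℝ))⁻¹ *
      (((M + M) * ∫ z, ‖w z‖ ∂μ) * √r) ^ r * ‖w l * c l‖ := by
    intro r l
    rw [hg, norm_mul]
    by_cases hl : l ∈ D
    · gcongr
      exact norm_fredholm_term_le hw (hA.bound_sub hl) r
    · simp [hq0 l hl]
  have hgsum : HasSum (fun r => ∫ l, g r l ∂μ) (∫ l, fredholmMinor μ w A l * (w l * c l) ∂μ) := by
    have h1 := hasSum_integral_of_summable_integral_norm hgint (by
      refine Summable.of_nonneg_of_le (fun r => integral_nonneg fun l => norm_nonneg _)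
        (fun r => integral_mono (hgint r).norm (hq.norm.const_mul _) (hgbd r)) ?_
      simp_rw [integral_const_mul]
      exact (summable_hadamard_bound _).mul_right _)
    have h2 : ∀ l, ∑' r, g r l = fredholmMinor μ w A l * (w l * c l) := fun l =>
      tsum_mul_right
    simpa only [h2] using h1
  have hd := (hasSum_fredholmDet hw hAc.bound).sub (hasSum_fredholmDet hw hA.bound)
  rw [← hd.tsum_eq, hd.summable.tsum_eq_zero_add]
  simp_rw [hterm]
  rw [← hgsum.tsum_eq]
  simp [hg]

/-- Adding the constant `1` to the kernel changes the determinant by the pairing of `1` with the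
first minors. Inserting `1 = v + ∫ A(·, l) w(l) v(l) dμ(l)` and the transposed equation satisfied by the
minors turns this pairing into `∫ w v` times the determinant. -/
theorem fredholmDet_add_one_sub (hw : IsWeight μ D w) (hA : IsBddKernel D M A) {v : X → ℂ}
    (hv : Integrable (fun l => w l * v l) μ)
    (heq : ∀ z ∈ D, v z + ∫ l, A z l * (w l * v l) ∂μ = 1) :
    fredholmDet μ w (fun z y => A z y + 1) - fredholmDet μ w A =
      (∫ l, w l * v l ∂μ) * fredholmDet μ w A := by
  set y := fredholmMinor μ w A with hy
  have hv0 : ∀ z, z ∉ D → w z * v z = 0 := fun z hz => by rw [hw.eq_zero z hz, zero_mul]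
  have h1 := fredholmDet_add_sub hw hA (c := fun _ => 1) (P := 1) measurable_const (by simp)
  have hminor : ∀ l ∈ D, ∫ z, (y z * w z) * A z l ∂μ = fredholmDet μ w A - y l := by
    intro l hl
    have h2 := fredholmDet_add_sub hw hA (c := fun z => -A z l) (P := M)
      (hA.measurable.comp (measurable_id.prodMk measurable_const)).neg
      (fun z hz => by rw [norm_neg]; exact hA.bound z hz l hl)
    simp only [← sub_eq_add_neg] at h2
    have h3 : fredholmDet μ w (fun z b => A z b - A z l) = y l := rfl
    rw [h3] at h2
    rw [← neg_sub, h2, ← integral_neg]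
    congr 1
    ext z
    ring
  have hyw : Integrable (fun z => y z * w z) μ :=
    integrable_fredholmMinor_mul hw hA hw.integrable hw.eq_zero
  have hywv : Integrable (fun z => y z * (w z * v z)) μ :=
    integrable_fredholmMinor_mul hw hA hv hv0
  have hprod : Integrable (fun p : X × X => (y p.1 * w p.1) * (A p.1 p.2 * (w p.2 * v p.2)))
      (μ.prod μ) := by
    refine ((hyw.norm.mul_prod hv.norm).const_mul M).mono'
      (hyw.aestronglyMeasurable.comp_fst.mul
        (hA.measurable.aestronglyMeasurable.mul hv.aestronglyMeasurable.comp_snd))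
      (.of_forall fun p => ?_)
    by_cases h1 : p.1 ∈ D
    · by_cases h2 : p.2 ∈ D
      · rw [norm_mul, norm_mul (A _ _)]
        have := hA.bound _ h1 _ h2
        calc _ ≤ ‖y p.1 * w p.1‖ * (M * ‖w p.2 * v p.2‖) := by gcongr
          _ = _ := by ring
      · simp [hv0 _ h2]
    · simp [hw.eq_zero _ h1]
  rw [h1]
  calc ∫ l, y l * (w l * 1) ∂μ
      = ∫ z, (y z * (w z * v z) + ∫ l, (y z * w z) * (A z l * (w l * v l)) ∂μ) ∂μ := by
        congr 1
        ext z
        rw [integral_const_mul]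
        by_cases hz : z ∈ D
        · rw [← heq z hz]; ring
        · simp [hw.eq_zero z hz]
    _ = ∫ z, y z * (w z * v z) ∂μ +
          ∫ l, (∫ z, (y z * w z) * (A z l * (w l * v l)) ∂μ) ∂μ := by
        rw [integral_add hywv hprod.integral_prod_left, integral_integral_swap hprod]
    _ = ∫ l, (y l * (w l * v l) + ∫ z, (y z * w z) * (A z l * (w l * v l)) ∂μ) ∂μ := by
        rw [integral_add hywv hprod.integral_prod_right]
    _ = ∫ l, (w l * v l) * fredholmDet μ w A ∂μ := by
        congr 1
        ext l
        have : ∀ z, (y z * w z) * (A z l * (w l * v l)) = (w l * v l) * ((y z * w z) * A z l) :=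
          fun z => by ring
        simp_rw [this]
        rw [integral_const_mul]
        by_cases hl : l ∈ D
        · rw [hminor l hl]; ring
        · simp [hv0 l hl]
    _ = _ := integral_mul_const _ _

end Minors

/-! ### Branches of the logarithm along a real variable -/

/-- A nowhere vanishing continuously differentiable function on an open subset of the line has a
differentiable logarithm. The constants of integration are fixed at one base point in each
connected component. -/
theorem exists_log_branch {f f' : ℝ → ℂ} {O : Set ℝ} (hO : IsOpen O)
    (hf : ∀ x ∈ O, HasDerivAt f (f' x) x) (hf' : ContinuousOn f' O) (hne : ∀ x ∈ O, f x ≠ 0) :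
    ∃ J : ℝ → ℂ, ∀ x ∈ O, Complex.exp (J x) = f x ∧ HasDerivAt J (f' x / f x) x := by
  classical
  set b : ℝ → ℝ := fun x => if h : x ∈ O then Set.ordConnectedProj O ⟨x, h⟩ else 0 with hb
  set J : ℝ → ℂ := fun x => Complex.log (f (b x)) + ∫ t in b x..x, f' t / f t with hJ
  have hbO : ∀ x ∈ O, Set.uIcc (b x) x ⊆ O := by
    intro x hx
    have h := Set.ordConnectedProj_mem_ordConnectedComponent O ⟨x, hx⟩
    rw [Set.mem_ordConnectedComponent, Set.uIcc_comm] at h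
    simpa [hb, hx] using h
  have hbeq : ∀ x ∈ O, ∀ y ∈ O, Set.uIcc x y ⊆ O → b y = b x := by
    intro x hx y hy hxy
    have h := (Set.ordConnectedProj_eq (s := O) (x := ⟨x, hx⟩) (y := ⟨y, hy⟩)).2 hxy
    simp [hb, hx, hy, h]
  have hq : ContinuousOn (fun t => f' t / f t) O :=
    hf'.div (fun x hx => (hf x hx).continuousAt.continuousWithinAt) hne
  have hder : ∀ x ∈ O, HasDerivAt J (f' x / f x) x := by
    intro x hx
    have h1 : HasDerivAt (fun y => Complex.log (f (b x)) + ∫ t in b x..y, f' t / f t)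
        (f' x / f x) x := by
      refine HasDerivAt.const_add _ (intervalIntegral.integral_hasDerivAt_right ?_ ?_ ?_)
      · exact (hq.mono (hbO x hx)).intervalIntegrable
      · exact hq.stronglyMeasurableAtFilter hO x hx
      · exact hq.continuousAt (hO.mem_nhds hx)
    refine h1.congr_of_eventuallyEq ?_
    obtain ⟨ε, hε, hεO⟩ := Metric.isOpen_iff.1 hO x hx
    filter_upwards [Metric.ball_mem_nhds x hε] with y hy
    have hxy : Set.uIcc x y ⊆ O :=
      ((convex_ball x ε).ordConnected.uIcc_subset (Metric.mem_ball_self hε) hy).trans hεO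
    simp only [hJ, hbeq x hx y (hεO hy) hxy]
  refine ⟨J, fun x hx => ⟨?_, hder x hx⟩⟩
  have hbx : b x ∈ O := hbO x hx Set.left_mem_uIcc
  have hbb : b (b x) = b x := by
    refine hbeq x hx (b x) hbx ?_
    rw [Set.uIcc_comm]
    exact hbO x hx
  have hconst : ∀ y ∈ Set.uIcc (b x) x, HasDerivWithinAt
      (fun y => f y * Complex.exp (-J y)) 0 (Set.uIcc (b x) x) y := by
    intro y hy
    have hyO := hbO x hx hy
    have h := (hf y hyO).mul (hder y hyO).neg.cexp
    refine (h.congr_deriv ?_).hasDerivWithinAt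
    have := hne y hyO
    field_simp
    ring
  have h1 := (convex_uIcc (b x) x).norm_image_sub_le_of_norm_hasDerivWithin_le
    (C := 0) hconst (by simp) Set.left_mem_uIcc Set.right_mem_uIcc
  rw [zero_mul, norm_le_zero_iff, sub_eq_zero] at h1
  have h2 : f (b x) * Complex.exp (-J (b x)) = 1 := by
    have : J (b x) = Complex.log (f (b x)) := by simp only [hJ, hbb]; simp
    rw [this, Complex.exp_neg, Complex.exp_log (hne _ hbx), mul_inv_cancel₀ (hne _ hbx)]
  simp only [h2] at h1
  rw [Complex.exp_neg] at h1
  field_simp at h1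
  exact h1.symm

/-! ### The tau function as a Cauchy determinant -/

namespace DLData

open Filter Topology

variable (S : DLData)

/-- The part of the plane wave factor that does not depend on `x₁` and `n₁`. -/
noncomputable def waveConst (k : ℂ) : ℂ :=
  Complex.exp (S.t.sum fun j s => k ^ (2 * j + 3) * (s : ℂ)) *
    S.N.prod fun i e => ((S.q i + k) / (S.q i - k)) ^ e

/-- The density on `D` whose Miwa factors with the parameters `p₁`, `-p₁`, `0` are raised to the
powers `i`, `j`, `n`, at `x₁ = 0`. -/
noncomputable def latticeWeightZero (i j n : ℤ) : ℂ × ℂ → ℂ :=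
  S.D.indicator fun z => S.waveConst z.1 * S.waveConst z.2 *
    (miwa S.p₁ z ^ i * miwa (-S.p₁) z ^ j * miwa 0 z ^ n) * S.h z

/-- The density on `D` with Miwa factors to the powers `i`, `j`, `n`, at `x₁ = x`. For `i = -m` and
`j = m` it is `ρ_n(k) σ_n(k') h(k, k')` at `n₁ = m`. -/
noncomputable def latticeWeight (i j n : ℤ) (x : ℝ) : ℂ × ℂ → ℂ := fun z =>
  Complex.exp ((z.1 + z.2) * x) * S.latticeWeightZero i j n z

/-- The tau function on the three-dimensional lattice of Miwa shifts with the parameters `p₁`, `-p₁`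
and `0`. -/
noncomputable def latticeTau (i j n : ℤ) (x : ℝ) : ℂ :=
  cauchyDet (S.μ.restrict S.D) (S.latticeWeight i j n x)

/-- The derivative of `latticeTau` with respect to `x₁`. -/
noncomputable def latticeTauDeriv (i j n : ℤ) (x : ℝ) : ℂ :=
  cauchyDetOne (S.μ.restrict S.D) (S.latticeWeight i j n x) -
    cauchyDet (S.μ.restrict S.D) (S.latticeWeight i j n x)

variable {S}

theorem latticeWeight_eq_zero (i j n : ℤ) (x : ℝ) (z : ℂ × ℂ) (hz : z ∉ S.D) :
    S.latticeWeight i j n x z = 0 := by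
  rw [latticeWeight, latticeWeightZero, Set.indicator_of_notMem hz, mul_zero]

theorem latticeWeight_of_mem (i j n : ℤ) (x : ℝ) {z : ℂ × ℂ} (hz : z ∈ S.D) :
    S.latticeWeight i j n x z = Complex.exp ((z.1 + z.2) * x) *
      (S.waveConst z.1 * S.waveConst z.2 *
        (miwa S.p₁ z ^ i * miwa (-S.p₁) z ^ j * miwa 0 z ^ n) * S.h z) := by
  rw [latticeWeight, latticeWeightZero, Set.indicator_of_mem hz]

section Admissible

variable {I : Set ℝ} (hS : S.Admissible I)
include hS

theorem Admissible.add_ne_zero {z : ℂ × ℂ} (hz : z ∈ S.D) :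
    S.p₁ - z.1 ≠ 0 ∧ S.p₁ + z.1 ≠ 0 ∧ S.p₁ - z.2 ≠ 0 ∧ S.p₁ + z.2 ≠ 0 := by
  obtain ⟨δ, hδ, h⟩ := hS.separated_p
  obtain ⟨h1, h2, h3, h4⟩ := h z hz
  exact ⟨norm_pos_iff.1 (hδ.trans_le h1), norm_pos_iff.1 (hδ.trans_le h2),
    norm_pos_iff.1 (hδ.trans_le h3), norm_pos_iff.1 (hδ.trans_le h4)⟩

theorem Admissible.miwa_ne_zero {z : ℂ × ℂ} (hz : z ∈ S.D) :
    miwa S.p₁ z ≠ 0 ∧ miwa (-S.p₁) z ≠ 0 ∧ miwa 0 z ≠ 0 := by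
  obtain ⟨h1, h2, h3, h4⟩ := hS.add_ne_zero hz
  obtain ⟨h5, h6⟩ := hS.ne_zero z hz
  refine ⟨div_ne_zero h1 h4, div_ne_zero ?_ ?_, div_ne_zero ?_ ?_⟩
  · rw [← neg_ne_zero]; convert h2 using 1; ring
  · rw [← neg_ne_zero]; convert h3 using 1; ring
  · simpa using h5
  · simpa using h6

theorem Admissible.rho_mul_sigma (x : ℝ) (m n : ℤ) {z : ℂ × ℂ} (hz : z ∈ S.D) :
    S.rho x m n z.1 * S.sigma x m n z.2 * S.h z = S.latticeWeight (-m) m n x z := by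
  obtain ⟨h1, h2, h3, h4⟩ := hS.add_ne_zero hz
  obtain ⟨h5, h6⟩ := hS.ne_zero z hz
  have hm : miwa S.p₁ z ^ (-m) * miwa (-S.p₁) z ^ m =
      ((S.p₁ + z.1) / (S.p₁ - z.1)) ^ m * ((S.p₁ + z.2) / (S.p₁ - z.2)) ^ m := by
    rw [zpow_neg, ← inv_zpow, ← mul_zpow, ← mul_zpow]
    congr 1
    have h7 : -S.p₁ + z.2 ≠ 0 := by
      rw [← neg_ne_zero]; convert h3 using 1; ring
    rw [miwa, miwa]
    field_simp
    ring
  have hn : z.1 ^ n * (-z.2) ^ (-n) = miwa 0 z ^ n := by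
    rw [zpow_neg, ← inv_zpow, ← mul_zpow, miwa, zero_sub, zero_add]
    congr 1
    field_simp
  rw [latticeWeight_of_mem _ _ _ _ hz, hm, ← hn, rho, sigma, wave, wave, waveConst, waveConst,
    add_mul, Complex.exp_add, Complex.exp_add, Complex.exp_add]
  ring

theorem Admissible.tau_eq (x : ℝ) (m n : ℤ) : S.tau x m n = S.latticeTau (-m) m n x := by
  have := hS.sigmaFinite
  rw [tau, latticeTau, cauchyDet, fredholmDet]
  congr 1
  ext r
  congr 1
  refine integral_congr_ae ?_
  have hae : ∀ᵐ z : Fin r → ℂ × ℂ ∂(Measure.pi fun _ => S.μ.restrict S.D), ∀ a, z a ∈ S.D :=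
    eventually_all.2 fun a => Measure.tendsto_eval_ae_ae.eventually
      (ae_restrict_mem hS.measurableSet_D)
  filter_upwards [hae] with z hz
  have h1 : (Matrix.of fun a b : Fin r =>
      S.rho x m n (z a).1 * Omega (z a).1 (z b).2 * S.sigma x m n (z b).2).det =
      (∏ a, S.rho x m n (z a).1) * ((∏ a, S.sigma x m n (z a).2) *
        (Matrix.of fun a b : Fin r => Omega (z a).1 (z b).2).det) := by
    rw [← Matrix.det_mul_row, ← Matrix.det_mul_column]
    congr 1
    ext a b
    simp only [Matrix.of_apply]
    ring
  rw [h1, ← Finset.prod_congr rfl fun a _ => hS.rho_mul_sigma x m n (hz a),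
    Finset.prod_mul_distrib, Finset.prod_mul_distrib]
  ring

/-- The weights `ρ_n σ_n` have finite absolute moments of all orders. -/
theorem Admissible.integrable_moment_diag {x : ℝ} (hx : x ∈ I) (m n : ℤ) (N : ℕ) :
    Integrable (fun z => (((1 + ‖z.1‖) * (1 + ‖z.2‖)) ^ N * (1 + ‖z.2⁻¹‖) : ℝ) *
      ‖S.latticeWeight (-m) m n x z‖) (S.μ.restrict S.D) := by
  set w := S.latticeWeight (-m) m n x with hw
  have hmem := ae_restrict_mem (μ := S.μ) hS.measurableSet_D
  have hmono : ∀ a b : ℤ, Integrable (fun z => ‖z.1‖ ^ a * ‖z.2‖ ^ b * ‖w z‖)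
      (S.μ.restrict S.D) := by
    intro a b
    refine (hS.integrable x hx m n a b).norm.congr ?_
    filter_upwards [hmem] with z hz
    rw [hw, ← hS.rho_mul_sigma x m n hz]
    simp only [norm_mul, norm_zpow]
    ring
  have h4 := ((((hmono 0 (-1)).add (hmono 0 N)).add (hmono N (-1))).add
    (hmono N N)).const_mul (2 ^ N * 2 ^ (N + 1))
  have hwm : AEStronglyMeasurable (fun z => ‖w z‖) (S.μ.restrict S.D) := by
    simpa using (hmono 0 0).aestronglyMeasurable
  refine h4.mono' (AEStronglyMeasurable.mul (Measurable.aestronglyMeasurable ?_) hwm) ?_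
  · fun_prop
  · filter_upwards [hmem] with z hz
    obtain ⟨h1, h2⟩ := hS.ne_zero z hz
    have hs : 0 ≤ ‖z.1‖ := norm_nonneg _
    have ht : 0 < ‖z.2‖ := norm_pos_iff.2 h2
    rw [Real.norm_of_nonneg (by positivity)]
    set s := ‖z.1‖
    rw [norm_inv]
    set t := ‖z.2‖
    have e1 : (1 + s) ^ N ≤ 2 ^ N * (1 + s ^ N) := by
      rcases le_total s 1 with h | h
      · calc (1 + s) ^ N ≤ 2 ^ N := pow_le_pow_left₀ (by linarith) (by linarith) N
          _ ≤ 2 ^ N * (1 + s ^ N) := le_mul_of_one_le_right (by positivity)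
              (by linarith [pow_nonneg hs N])
      · calc (1 + s) ^ N ≤ (2 * s) ^ N := pow_le_pow_left₀ (by linarith) (by linarith) N
          _ = 2 ^ N * s ^ N := mul_pow _ _ _
          _ ≤ _ := by gcongr; linarith
    have e2 : (1 + t) ^ N * (1 + t⁻¹) ≤ 2 ^ (N + 1) * (t⁻¹ + t ^ N) := by
      have htN : 0 ≤ t ^ N := by positivity
      rcases le_total t 1 with h | h
      · have h3 : 1 ≤ t⁻¹ := (one_le_inv₀ ht).2 h
        calc (1 + t) ^ N * (1 + t⁻¹) ≤ 2 ^ N * (2 * t⁻¹) := by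
              gcongr <;> linarith
          _ = 2 ^ (N + 1) * t⁻¹ := by ring
          _ ≤ _ := by gcongr; linarith
      · have h3 : t⁻¹ ≤ 1 := inv_le_one_of_one_le₀ h
        calc (1 + t) ^ N * (1 + t⁻¹) ≤ (2 * t) ^ N * 2 := by
              gcongr <;> linarith
          _ = 2 ^ (N + 1) * t ^ N := by rw [mul_pow]; ring
          _ ≤ _ := by gcongr; linarith [inv_pos.2 ht]
    calc ((1 + s) * (1 + t)) ^ N * (1 + t⁻¹) * ‖w z‖
        = (1 + s) ^ N * ((1 + t) ^ N * (1 + t⁻¹)) * ‖w z‖ := by rw [mul_pow]; ring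
      _ ≤ (2 ^ N * (1 + s ^ N)) * (2 ^ (N + 1) * (t⁻¹ + t ^ N)) * ‖w z‖ := by gcongr
      _ = _ := by
        simp only [Pi.add_apply, zpow_natCast, zpow_zero, zpow_neg_one]
        ring

/-- A Miwa factor with parameter `p₁` grows at most polynomially, and so does its inverse. -/
theorem Admissible.norm_miwa_zpow_le : ∃ c : ℝ, 0 ≤ c ∧ ∀ z ∈ S.D, ∀ l : ℤ,
    ‖miwa S.p₁ z ^ l‖ ≤ c ^ l.natAbs * ((1 + ‖z.1‖) * (1 + ‖z.2‖)) ^ l.natAbs := by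
  obtain ⟨δ, hδ, hδD⟩ := hS.separated_p
  have key : ∀ k k' : ℂ, ‖S.p₁‖ + ‖k‖ ≤ (1 + ‖S.p₁‖) * ((1 + ‖k‖) * (1 + ‖k'‖)) := by
    intro k k'
    nlinarith [norm_nonneg S.p₁, norm_nonneg k, norm_nonneg k',
      mul_nonneg (norm_nonneg S.p₁) (norm_nonneg k), mul_nonneg (norm_nonneg k) (norm_nonneg k'),
      mul_nonneg (norm_nonneg S.p₁) (norm_nonneg k'),
      mul_nonneg (norm_nonneg S.p₁) (mul_nonneg (norm_nonneg k) (norm_nonneg k'))]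
  refine ⟨(1 + ‖S.p₁‖) / δ, by positivity, fun z hz l => ?_⟩
  obtain ⟨h1, -, -, h4⟩ := hδD z hz
  rw [← mul_pow]
  have e1 : ‖miwa S.p₁ z‖ ≤ (1 + ‖S.p₁‖) / δ * ((1 + ‖z.1‖) * (1 + ‖z.2‖)) := by
    rw [miwa, norm_div, div_mul_eq_mul_div]
    exact div_le_div₀ (by positivity) ((norm_sub_le _ _).trans (key _ _)) hδ h4
  have e2 : ‖(miwa S.p₁ z)⁻¹‖ ≤ (1 + ‖S.p₁‖) / δ * ((1 + ‖z.1‖) * (1 + ‖z.2‖)) := by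
    rw [miwa, inv_div, norm_div, div_mul_eq_mul_div, mul_comm (1 + ‖z.1‖)]
    exact div_le_div₀ (by positivity) ((norm_add_le _ _).trans (key _ _)) hδ h1
  obtain ⟨N, rfl | rfl⟩ := l.eq_nat_or_neg
  · simpa using pow_le_pow_left₀ (norm_nonneg _) e1 N
  · rw [zpow_neg, ← inv_zpow]
    simpa using pow_le_pow_left₀ (norm_nonneg _) e2 N

theorem Admissible.latticeWeight_eq_mul (i j n : ℤ) (x : ℝ) {z : ℂ × ℂ} (hz : z ∈ S.D) :
    S.latticeWeight i j n x z = S.latticeWeight (-j) j n x z * miwa S.p₁ z ^ (i + j) := by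
  rw [latticeWeight_of_mem _ _ _ _ hz, latticeWeight_of_mem _ _ _ _ hz,
    show i = -j + (i + j) by ring, zpow_add₀ (hS.miwa_ne_zero hz).1]
  ring_nf

theorem Admissible.aestronglyMeasurable_latticeWeight {x : ℝ} (hx : x ∈ I) (i j n : ℤ) :
    AEStronglyMeasurable (S.latticeWeight i j n x) (S.μ.restrict S.D) := by
  have h1 : Measurable (miwa S.p₁) := by unfold miwa; fun_prop
  have h2 : Measurable fun z => miwa S.p₁ z ^ (i + j) := by
    obtain ⟨k, h | h⟩ := (i + j).eq_nat_or_neg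
    · simpa [h] using h1.pow_const k
    · simp only [h, zpow_neg, zpow_natCast]
      exact (h1.pow_const k).inv
  refine ((hS.integrable x hx j n 0 0).aestronglyMeasurable.mul h2.aestronglyMeasurable).congr ?_
  filter_upwards [ae_restrict_mem (μ := S.μ) hS.measurableSet_D] with z hz
  simp [hS.latticeWeight_eq_mul i j n x hz, ← hS.rho_mul_sigma x j n hz]

/-- The weights on the lattice, too, have finite absolute moments of all orders. -/
theorem Admissible.integrable_moment {x : ℝ} (hx : x ∈ I) (i j n : ℤ) (N : ℕ) :
    Integrable (fun z => (((1 + ‖z.1‖) * (1 + ‖z.2‖)) ^ N * (1 + ‖z.2⁻¹‖) : ℝ) *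
      ‖S.latticeWeight i j n x z‖) (S.μ.restrict S.D) := by
  obtain ⟨c, hc, hcD⟩ := hS.norm_miwa_zpow_le
  set l := i + j with hl
  have h0 := (hS.integrable_moment_diag hx j n (N + l.natAbs)).const_mul (c ^ l.natAbs)
  refine h0.mono' (AEStronglyMeasurable.mul (Measurable.aestronglyMeasurable (by fun_prop))
    (hS.aestronglyMeasurable_latticeWeight hx i j n).norm) ?_
  filter_upwards [ae_restrict_mem (μ := S.μ) hS.measurableSet_D] with z hz
  rw [Real.norm_of_nonneg (by positivity), hS.latticeWeight_eq_mul i j n x hz, norm_mul, pow_add]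
  have h2 := hcD z hz l
  calc _ ≤ ((1 + ‖z.1‖) * (1 + ‖z.2‖)) ^ N * (1 + ‖z.2⁻¹‖) *
        (‖S.latticeWeight (-j) j n x z‖ *
          (c ^ l.natAbs * ((1 + ‖z.1‖) * (1 + ‖z.2‖)) ^ l.natAbs)) := by gcongr
    _ = _ := by ring

theorem Admissible.integrable_mul_latticeWeight {x : ℝ} (hx : x ∈ I) (i j n : ℤ) {N : ℕ}
    {Q : ℂ × ℂ → ℂ} {c : ℝ} (hQ : Measurable Q)
    (hQc : ∀ z ∈ S.D, ‖Q z‖ ≤ c * (((1 + ‖z.1‖) * (1 + ‖z.2‖)) ^ N * (1 + ‖z.2⁻¹‖))) :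
    Integrable (fun z => Q z * S.latticeWeight i j n x z) (S.μ.restrict S.D) := by
  refine ((hS.integrable_moment hx i j n N).const_mul c).mono' (hQ.aestronglyMeasurable.mul
    (hS.aestronglyMeasurable_latticeWeight hx i j n)) ?_
  filter_upwards [ae_restrict_mem (μ := S.μ) hS.measurableSet_D] with z hz
  rw [norm_mul, ← mul_assoc]
  exact mul_le_mul_of_nonneg_right (hQc z hz) (norm_nonneg _)

theorem Admissible.isWeight {x : ℝ} (hx : x ∈ I) (i j n : ℤ) :
    IsWeight (S.μ.restrict S.D) S.D (S.latticeWeight i j n x) where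
  integrable := by
    have h := hS.integrable_mul_latticeWeight hx i j n (N := 0) (Q := fun _ => 1) (c := 1)
      measurable_const (fun z _ => by simp)
    simpa using h
  eq_zero := latticeWeight_eq_zero i j n x

end Admissible

end DLData

/-! ### Derivatives and bilinear equations on the lattice -/

namespace DLData

open Filter Topology

variable {S : DLData} {I : Set ℝ}

theorem Admissible.isBddKernel (hS : S.Admissible I) :
    ∃ M, IsBddKernel S.D M fun z y => Omega z.1 y.2 := by
  obtain ⟨δ, hδ, hδD⟩ := hS.separated_kernel
  exact ⟨_, measurable_Omega, norm_Omega_le hδ hδD⟩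

theorem Admissible.hasDerivAt_moment (hS : S.Admissible I) (hI : IsOpen I) {x : ℝ} (hx : x ∈ I)
    (i j n : ℤ) (d : ℕ) :
    HasDerivAt (fun y => fredholmMoment (S.μ.restrict S.D) (fun z => z.1 + z.2) d
        (S.latticeWeight i j n y) fun z y => Omega z.1 y.2)
      (fredholmMoment (S.μ.restrict S.D) (fun z => z.1 + z.2) (d + 1)
        (S.latticeWeight i j n x) fun z y => Omega z.1 y.2) x := by
  have := hS.sigmaFinite
  obtain ⟨M, hM⟩ := hS.isBddKernel
  refine hasDerivAt_fredholmMoment (w₀ := S.latticeWeightZero i j n) hI (by fun_prop) hM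
    (fun z hz => Set.indicator_of_notMem hz _) (fun y hy N => ?_) d hx
  refine hS.integrable_mul_latticeWeight hy i j n (N := N) (c := 1) (by fun_prop) fun z _ => ?_
  rw [norm_pow, Complex.norm_of_nonneg (by positivity), one_mul]
  have h1 : 1 + ‖z.1 + z.2‖ ≤ (1 + ‖z.1‖) * (1 + ‖z.2‖) := by
    nlinarith [norm_add_le z.1 z.2, mul_nonneg (norm_nonneg z.1) (norm_nonneg z.2)]
  calc (1 + ‖z.1 + z.2‖) ^ N ≤ ((1 + ‖z.1‖) * (1 + ‖z.2‖)) ^ N :=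
        pow_le_pow_left₀ (by positivity) h1 N
    _ ≤ _ := le_mul_of_one_le_right (by positivity) (by linarith [norm_nonneg z.2⁻¹])

theorem Admissible.latticeTauDeriv_eq (hS : S.Admissible I) {x : ℝ} (hx : x ∈ I) (i j n : ℤ) :
    S.latticeTauDeriv i j n x = fredholmMoment (S.μ.restrict S.D) (fun z => z.1 + z.2) 1
      (S.latticeWeight i j n x) fun z y => Omega z.1 y.2 := by
  have := hS.sigmaFinite
  obtain ⟨δ, hδ, hδD⟩ := hS.separated_kernel
  exact (fredholmMoment_one_eq hδ hδD (hS.isWeight hx i j n)).symm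

theorem Admissible.hasDerivAt_latticeTau (hS : S.Admissible I) (hI : IsOpen I) {x : ℝ}
    (hx : x ∈ I) (i j n : ℤ) :
    HasDerivAt (S.latticeTau i j n) (S.latticeTauDeriv i j n x) x := by
  have h := hS.hasDerivAt_moment hI hx i j n 0
  rw [hS.latticeTauDeriv_eq hx]
  simp only [fredholmMoment_zero] at h
  exact h

theorem Admissible.differentiableAt_latticeTauDeriv (hS : S.Admissible I) (hI : IsOpen I) {x : ℝ}
    (hx : x ∈ I) (i j n : ℤ) : DifferentiableAt ℝ (S.latticeTauDeriv i j n) x := by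
  refine (hS.hasDerivAt_moment hI hx i j n 1).differentiableAt.congr_of_eventuallyEq ?_
  filter_upwards [hI.mem_nhds hx] with y hy
  exact hS.latticeTauDeriv_eq hy i j n

theorem Admissible.latticeWeight_mul_miwa (hS : S.Admissible I) (i j n : ℤ) (x : ℝ) :
    (fun z => S.latticeWeight i j n x z * miwa S.p₁ z) = S.latticeWeight (i + 1) j n x ∧
    (fun z => S.latticeWeight i j n x z * miwa (-S.p₁) z) = S.latticeWeight i (j + 1) n x ∧
    (fun z => S.latticeWeight i j n x z * miwa 0 z) = S.latticeWeight i j (n + 1) x := by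
  refine ⟨?_, ?_, ?_⟩ <;>
  · ext z
    by_cases hz : z ∈ S.D
    · obtain ⟨h1, h2, h3⟩ := hS.miwa_ne_zero hz
      simp only [latticeWeight_of_mem _ _ _ _ hz, zpow_add_one₀ h1, zpow_add_one₀ h2,
        zpow_add_one₀ h3]
      ring
    · simp only [latticeWeight_eq_zero _ _ _ _ _ hz, zero_mul]

theorem Admissible.inv_bound (hS : S.Admissible I) {a : ℂ}
    (ha : a = S.p₁ ∨ a = -S.p₁ ∨ a = 0) :
    ∃ c : ℝ, ∀ z ∈ S.D, a + z.2 ≠ 0 ∧ ‖(a + z.2)⁻¹‖ ≤ c * (1 + ‖z.2⁻¹‖) := by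
  obtain ⟨δ, hδ, hδD⟩ := hS.separated_p
  have key : ∀ v z : ℂ, δ ≤ ‖v‖ → ‖v⁻¹‖ ≤ δ⁻¹ * (1 + ‖z⁻¹‖) := by
    intro v z hv
    rw [norm_inv]
    exact (inv_anti₀ hδ hv).trans
      (le_mul_of_one_le_right (by positivity) (by linarith [norm_nonneg z⁻¹]))
  rcases ha with rfl | rfl | rfl
  · exact ⟨δ⁻¹, fun z hz => ⟨(hS.add_ne_zero hz).2.2.2, key _ _ (hδD z hz).2.2.2⟩⟩
  · refine ⟨δ⁻¹, fun z hz => ?_⟩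
    have h1 : ‖-S.p₁ + z.2‖ = ‖S.p₁ - z.2‖ := by rw [← norm_neg]; congr 1; ring
    have h2 : δ ≤ ‖-S.p₁ + z.2‖ := h1 ▸ (hδD z hz).2.2.1
    exact ⟨norm_pos_iff.1 (hδ.trans_le h2), key _ _ h2⟩
  · exact ⟨1, fun z hz => ⟨by simpa using (hS.ne_zero z hz).2, by simp⟩⟩

theorem Admissible.latticeTau_bilinear (hS : S.Admissible I) {x : ℝ} (hx : x ∈ I) (i j n : ℤ)
    {a b : ℂ} (ha : a = S.p₁ ∨ a = -S.p₁ ∨ a = 0) (hb : b = S.p₁ ∨ b = -S.p₁ ∨ b = 0) :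
    (cauchyDetOne (S.μ.restrict S.D) (fun z => S.latticeWeight i j n x z * miwa a z) -
        cauchyDet (S.μ.restrict S.D) (fun z => S.latticeWeight i j n x z * miwa a z)) *
      cauchyDet (S.μ.restrict S.D) (fun z => S.latticeWeight i j n x z * miwa b z) -
    cauchyDet (S.μ.restrict S.D) (fun z => S.latticeWeight i j n x z * miwa a z) *
      (cauchyDetOne (S.μ.restrict S.D) (fun z => S.latticeWeight i j n x z * miwa b z) -
        cauchyDet (S.μ.restrict S.D) (fun z => S.latticeWeight i j n x z * miwa b z)) =
    (b - a) * (cauchyDet (S.μ.restrict S.D) (fun z => S.latticeWeight i j n x z * miwa a z) *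
        cauchyDet (S.μ.restrict S.D) (fun z => S.latticeWeight i j n x z * miwa b z) -
      S.latticeTau i j n x * cauchyDet (S.μ.restrict S.D)
        (fun z => S.latticeWeight i j n x z * miwa a z * miwa b z)) := by
  have := hS.sigmaFinite
  obtain ⟨δ, hδ, hδD⟩ := hS.separated_kernel
  obtain ⟨ca, hca⟩ := hS.inv_bound ha
  obtain ⟨cb, hcb⟩ := hS.inv_bound hb
  refine cauchyDet_bilinear hδ hδD (fun z hz => (hca z hz).1) (fun z hz => (hcb z hz).1)
    (latticeWeight_eq_zero i j n x) ?_
  have hQ : Measurable fun z : ℂ × ℂ =>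
      (((1 + ‖z.1‖ : ℝ) : ℂ) * ((1 + ‖(a + z.2)⁻¹‖ + ‖(b + z.2)⁻¹‖ : ℝ) : ℂ)) := by
    refine Measurable.mul (by fun_prop) (Complex.measurable_ofReal.comp ?_)
    exact (measurable_const.add (Measurable.norm (by fun_prop))).add (Measurable.norm (by fun_prop))
  refine (hS.integrable_mul_latticeWeight hx i j n (N := 1) (c := 1 + ca + cb) hQ
    fun z hz => ?_).congr (.of_forall fun z => mul_comm _ _)
  have h1 := (hca z hz).2
  have h2 := (hcb z hz).2
  rw [norm_mul, Complex.norm_of_nonneg (by positivity), Complex.norm_of_nonneg (by positivity),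
    pow_one]
  have h3 : 1 + ‖(a + z.2)⁻¹‖ + ‖(b + z.2)⁻¹‖ ≤ (1 + ca + cb) * (1 + ‖z.2⁻¹‖) := by
    linarith [norm_nonneg z.2⁻¹]
  have h4 : (0 : ℝ) ≤ (1 + ca + cb) * (1 + ‖z.2⁻¹‖) := le_trans (by positivity) h3
  calc (1 + ‖z.1‖) * (1 + ‖(a + z.2)⁻¹‖ + ‖(b + z.2)⁻¹‖)
      ≤ (1 + ‖z.1‖) * ((1 + ca + cb) * (1 + ‖z.2⁻¹‖)) := by gcongr
    _ ≤ ((1 + ‖z.1‖) * (1 + ‖z.2‖)) * ((1 + ca + cb) * (1 + ‖z.2⁻¹‖)) := by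
        refine mul_le_mul_of_nonneg_right ?_ h4
        exact le_mul_of_one_le_right (by positivity) (by linarith [norm_nonneg z.2])
    _ = _ := by ring

/-- The bilinear equation for the shifts with the parameters `p₁` and `-p₁`. -/
theorem Admissible.bilinear_pos_neg (hS : S.Admissible I) {x : ℝ} (hx : x ∈ I) (i j n : ℤ) :
    S.latticeTauDeriv (i + 1) j n x * S.latticeTau i (j + 1) n x -
      S.latticeTau (i + 1) j n x * S.latticeTauDeriv i (j + 1) n x =
    -(2 * S.p₁) * (S.latticeTau (i + 1) j n x * S.latticeTau i (j + 1) n x -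
      S.latticeTau i j n x * S.latticeTau (i + 1) (j + 1) n x) := by
  have h := hS.latticeTau_bilinear hx i j n (a := S.p₁) (b := -S.p₁) (by simp) (by simp)
  obtain ⟨h1, h2, -⟩ := hS.latticeWeight_mul_miwa i j n x
  obtain ⟨-, h3, -⟩ := hS.latticeWeight_mul_miwa (i + 1) j n x
  simp only [congrFun h1] at h
  rw [h2, h3] at h
  simp only [latticeTauDeriv, latticeTau] at h ⊢
  rw [h]
  ring

/-- The bilinear equation for the shifts with the parameters `p₁` and `0`. -/
theorem Admissible.bilinear_pos_zero (hS : S.Admissible I) {x : ℝ} (hx : x ∈ I) (i j n : ℤ) :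
    S.latticeTauDeriv (i + 1) j n x * S.latticeTau i j (n + 1) x -
      S.latticeTau (i + 1) j n x * S.latticeTauDeriv i j (n + 1) x =
    -S.p₁ * (S.latticeTau (i + 1) j n x * S.latticeTau i j (n + 1) x -
      S.latticeTau i j n x * S.latticeTau (i + 1) j (n + 1) x) := by
  have h := hS.latticeTau_bilinear hx i j n (a := S.p₁) (b := 0) (by simp) (by simp)
  obtain ⟨h1, -, h2⟩ := hS.latticeWeight_mul_miwa i j n x
  obtain ⟨-, -, h3⟩ := hS.latticeWeight_mul_miwa (i + 1) j n x
  simp only [congrFun h1] at h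
  rw [h2, h3] at h
  simp only [latticeTauDeriv, latticeTau] at h ⊢
  rw [h]
  ring

/-- The bilinear equation for the shifts with the parameters `-p₁` and `0`. -/
theorem Admissible.bilinear_neg_zero (hS : S.Admissible I) {x : ℝ} (hx : x ∈ I) (i j n : ℤ) :
    S.latticeTauDeriv i (j + 1) n x * S.latticeTau i j (n + 1) x -
      S.latticeTau i (j + 1) n x * S.latticeTauDeriv i j (n + 1) x =
    S.p₁ * (S.latticeTau i (j + 1) n x * S.latticeTau i j (n + 1) x -
      S.latticeTau i j n x * S.latticeTau i (j + 1) (n + 1) x) := by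
  have h := hS.latticeTau_bilinear hx i j n (a := -S.p₁) (b := 0) (by simp) (by simp)
  obtain ⟨-, h1, h2⟩ := hS.latticeWeight_mul_miwa i j n x
  obtain ⟨-, -, h3⟩ := hS.latticeWeight_mul_miwa i (j + 1) n x
  simp only [congrFun h1] at h
  rw [h2, h3] at h
  simp only [latticeTauDeriv, latticeTau] at h ⊢
  rw [h]
  ring

/-- The potential of any solution of the linear integral equation is the logarithmic derivative of
the tau function. -/
theorem Admissible.latticeTauDeriv_eq_potential_mul (hS : S.Admissible I) {x : ℝ} (hx : x ∈ I)
    (m n : ℤ) {u : ℂ → ℤ → ℂ} (hu : S.IsSolution x m n u) :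
    S.latticeTauDeriv (-m) m n x = S.potential x m n u 0 0 * S.latticeTau (-m) m n x := by
  have := hS.sigmaFinite
  obtain ⟨M, hM⟩ := hS.isBddKernel
  obtain ⟨hint, heq⟩ := hu 0
  set w := S.latticeWeight (-m) m n x with hw
  have hmem := ae_restrict_mem (μ := S.μ) hS.measurableSet_D
  -- the solution with the plane wave factor `ρ_n` removed
  set v : ℂ × ℂ → ℂ := fun z =>
    1 - S.zetaInt fun y => Omega z.1 y.2 * S.sigma x m n y.2 * u y.1 0 with hv
  have huv : ∀ z ∈ S.D, u z.1 0 = S.rho x m n z.1 * v z := by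
    intro z hz
    have h1 := heq z.1 ⟨z, hz, rfl⟩
    have h2 : (S.zetaInt fun y => S.rho x m n z.1 * Omega z.1 y.2 * S.sigma x m n y.2 * u y.1 0) =
        S.rho x m n z.1 * S.zetaInt fun y => Omega z.1 y.2 * S.sigma x m n y.2 * u y.1 0 := by
      rw [zetaInt, zetaInt, ← integral_const_mul]
      congr 1
      ext y
      ring
    rw [h2, zpow_zero] at h1
    rw [hv, mul_sub, ← h1]
    ring
  have hwv : ∀ z ∈ S.D, w z * v z = S.sigma x m n z.2 * u z.1 0 * S.h z := by
    intro z hz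
    rw [hw, ← hS.rho_mul_sigma x m n hz, huv z hz]
    ring
  have hvint : Integrable (fun z => w z * v z) (S.μ.restrict S.D) := by
    refine hint.congr ?_
    filter_upwards [hmem] with z hz
    exact (hwv z hz).symm
  have hveq : ∀ z ∈ S.D, v z + ∫ l, Omega z.1 l.2 * (w l * v l) ∂(S.μ.restrict S.D) = 1 := by
    intro z _
    have h1 : ∫ l, Omega z.1 l.2 * (w l * v l) ∂(S.μ.restrict S.D) =
        S.zetaInt fun y => Omega z.1 y.2 * S.sigma x m n y.2 * u y.1 0 := by
      refine integral_congr_ae ?_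
      filter_upwards [hmem] with l hl
      rw [hwv l hl]
      ring
    rw [h1, hv]
    ring
  have key := fredholmDet_add_one_sub (hS.isWeight hx (-m) m n) hM hvint hveq
  have hpot : S.potential x m n u 0 0 = ∫ l, w l * v l ∂(S.μ.restrict S.D) := by
    refine integral_congr_ae ?_
    filter_upwards [hmem] with l hl
    rw [hwv l hl, zpow_zero]
    ring
  rw [hpot]
  exact key

end DLData

/-! ### The differential-difference equation -/

/-- The discrete bilinear equation for three shifts `a`, `b`, `c` of a nonzero `f` follows from the
three differential ones, by the cyclic identity
`c (a' b - a b') + b (c' a - c a') + a (b' c - b c') = 0`. -/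
theorem three_term_of_bilinear {p f a b c a' b' c' ab ac bc : ℂ}
    (hab : a' * b - a * b' = -(2 * p) * (a * b - f * ab))
    (hac : a' * c - a * c' = -p * (a * c - f * ac))
    (hbc : b' * c - b * c' = p * (b * c - f * bc)) (hf : f ≠ 0) (hp : p ≠ 0) :
    2 * c * ab = a * bc + b * ac := by
  have h : p * f * (2 * c * ab - (a * bc + b * ac)) = 0 := by
    linear_combination -(c * hab) + b * hac - a * hbc
  exact sub_eq_zero.1 ((mul_eq_zero.1 h).resolve_left (mul_ne_zero hp hf))

/-- The dual form of `three_term_of_bilinear`: here `F` is the common further shift of the functions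
`a`, `b`, `c`. -/
theorem three_term_of_bilinear_dual {p F a b c a' b' c' ab ac bc : ℂ}
    (hab : a' * b - a * b' = -(2 * p) * (a * b - ab * F))
    (hac : c' * a - c * a' = p * (c * a - ac * F))
    (hbc : c' * b - c * b' = -p * (c * b - bc * F)) (hF : F ≠ 0) (hp : p ≠ 0) :
    2 * c * ab = a * bc + b * ac := by
  have h : p * F * (2 * c * ab - (a * bc + b * ac)) = 0 := by
    linear_combination -(c * hab) - b * hac + a * hbc
  exact sub_eq_zero.1 ((mul_eq_zero.1 h).resolve_left (mul_ne_zero hp hF))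

/-- Evaluation of the quotients on the right-hand side of the differential-difference equation. -/
theorem quotient_eq_of_three_term {p f F g T₀ T₁ R₀ R₁ : ℂ} (hT₀ : T₀ ≠ 0)
    (hR₀ : R₀ ≠ 0) (hR₁ : R₁ ≠ 0) (hF : F ≠ 0) (h : 2 * f * F = T₀ * R₁ + T₁ * R₀)
    (hne : 1 + R₀ / R₁ / (T₀ / T₁) ≠ 0) :
    2 * p * (f * g) / (R₀ * R₁) / (1 + R₀ / R₁ / (T₀ / T₁)) = p * T₀ * g / (F * R₀) := by
  have h1 : 1 + R₀ / R₁ / (T₀ / T₁) = 2 * f * F / (R₁ * T₀) := by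
    rw [h]
    field_simp
  have hf : f ≠ 0 := by
    rintro rfl
    exact hne (by rw [h1]; simp)
  rw [h1]
  field_simp

namespace DLData

variable {S : DLData} {I : Set ℝ}

/-- `2 p₁ + u - ũ` as a quotient of tau functions. -/
theorem Admissible.two_mul_add_sub_eq (hS : S.Admissible I) {x : ℝ} (hx : x ∈ I) (m n : ℤ)
    {u v : ℂ} (h0 : S.latticeTau (-m) m n x ≠ 0)
    (h1 : S.latticeTau (-(m + 1)) (m + 1) n x ≠ 0)
    (hu : S.latticeTauDeriv (-m) m n x = u * S.latticeTau (-m) m n x)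
    (hv : S.latticeTauDeriv (-(m + 1)) (m + 1) n x = v * S.latticeTau (-(m + 1)) (m + 1) n x) :
    2 * S.p₁ + u - v = 2 * S.p₁ * (S.latticeTau (-(m + 1)) m n x * S.latticeTau (-m) (m + 1) n x) /
      (S.latticeTau (-m) m n x * S.latticeTau (-(m + 1)) (m + 1) n x) := by
  have h := hS.bilinear_pos_neg hx (-(m + 1)) m n
  rw [show -(m + 1) + 1 = -m by ring] at h
  rw [hu, hv] at h
  rw [eq_div_iff (mul_ne_zero h0 h1)]
  linear_combination h

end DLData

theorem mainTheorem2 (S : DLData) (I : Set ℝ) (hI : IsOpen I) (hS : S.Admissible I)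
    (bu : ℝ → ℤ → ℤ → ℂ → ℤ → ℂ)
    (hbu : ∀ x ∈ I, ∀ m n : ℤ, S.tau x m n ≠ 0 → S.IsSolution x m n (bu x m n))
    (u : ℝ → ℤ → ℤ → ℂ)
    (hu : ∀ (x : ℝ) (m n : ℤ), u x m n = S.potential x m n (bu x m n) 0 0) :
    -- `J = ∂₁⁻¹ u`, the integration constants being fixed by `exp J = τ`
    ∃ J : ℝ → ℤ → ℤ → ℂ,
      (∀ x ∈ I, ∀ m n : ℤ, S.tau x m n ≠ 0 →
        Complex.exp (J x m n) = S.tau x m n ∧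
        HasDerivAt (fun s => J s m n) (u x m n) x ∧
        DifferentiableAt ℝ (fun s => u s m n) x) ∧
      ∀ x ∈ I, ∀ m n : ℤ,
        (∀ m' ∈ ({m, m + 1} : Set ℤ), ∀ n' ∈ ({n - 1, n, n + 1} : Set ℤ), S.tau x m' n' ≠ 0) →
        2 * S.p₁ + u x m n - u x (m + 1) n ≠ 0 →
        1 + Complex.exp ((J x m (n + 1) - J x (m + 1) (n + 1)) - (J x m n - J x (m + 1) n)) ≠ 0 →
        1 + Complex.exp ((J x m (n - 1) - J x (m + 1) (n - 1)) - (J x m n - J x (m + 1) n)) ≠ 0 →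
        logDeriv (fun s => 2 * S.p₁ + u s m n - u s (m + 1) n) x =
          u x m (n + 1) - 2 * u x m n + u x m (n - 1) + (2 * S.p₁ + u x m n - u x (m + 1) n)
          - (2 * S.p₁ + u x m (n + 1) - u x (m + 1) (n + 1)) /
            (1 + Complex.exp
              ((J x m (n + 1) - J x (m + 1) (n + 1)) - (J x m n - J x (m + 1) n)))
          - (2 * S.p₁ + u x m (n - 1) - u x (m + 1) (n - 1)) /
            (1 + Complex.exp
              ((J x m (n - 1) - J x (m + 1) (n - 1)) - (J x m n - J x (m + 1) n))) := by
  have htau : ∀ x m n, S.tau x m n = S.latticeTau (-m) m n x := hS.tau_eq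
  have hder : ∀ x ∈ I, ∀ i j n : ℤ,
      HasDerivAt (S.latticeTau i j n) (S.latticeTauDeriv i j n x) x :=
    fun x hx i j n => hS.hasDerivAt_latticeTau hI hx i j n
  have hder2 : ∀ x ∈ I, ∀ i j n : ℤ, DifferentiableAt ℝ (S.latticeTauDeriv i j n) x :=
    fun x hx i j n => hS.differentiableAt_latticeTauDeriv hI hx i j n
  set O : ℤ → ℤ → Set ℝ := fun m n => {x | x ∈ I ∧ S.latticeTau (-m) m n x ≠ 0} with hO
  have hOo : ∀ m n, IsOpen (O m n) := by
    intro m n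
    rw [isOpen_iff_mem_nhds]
    rintro x ⟨hx, hne⟩
    exact Filter.inter_mem (hI.mem_nhds hx)
      ((hder x hx _ _ _).continuousAt.eventually_ne hne)
  have hud : ∀ m n, ∀ x ∈ O m n,
      S.latticeTauDeriv (-m) m n x = u x m n * S.latticeTau (-m) m n x := by
    rintro m n x ⟨hx, hne⟩
    rw [hu]
    exact hS.latticeTauDeriv_eq_potential_mul hx m n (hbu x hx m n (by rwa [htau]))
  have huq : ∀ m n, ∀ x ∈ O m n,
      u x m n = S.latticeTauDeriv (-m) m n x / S.latticeTau (-m) m n x := fun m n x hx =>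
    (eq_div_iff hx.2).2 (hud m n x hx).symm
  have hbranch : ∀ m n, ∃ J : ℝ → ℂ, ∀ x ∈ O m n, Complex.exp (J x) = S.latticeTau (-m) m n x ∧
      HasDerivAt J (S.latticeTauDeriv (-m) m n x / S.latticeTau (-m) m n x) x := fun m n =>
    exists_log_branch (hOo m n) (fun x hx => hder x hx.1 _ _ _)
      (fun x hx => (hder2 x hx.1 _ _ _).continuousAt.continuousWithinAt) fun x hx => hx.2
  choose J hJ using hbranch
  refine ⟨fun x m n => J m n x, fun x hx m n hne => ?_, fun x hx m n hne hv hp1 hm1 => ?_⟩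
  · rw [htau] at hne ⊢
    refine ⟨(hJ m n x ⟨hx, hne⟩).1, ?_, ?_⟩
    · rw [huq m n x ⟨hx, hne⟩]
      exact (hJ m n x ⟨hx, hne⟩).2
    · refine ((hder2 x hx (-m) m n).fun_div
        (hder x hx (-m) m n).differentiableAt hne).congr_of_eventuallyEq ?_
      filter_upwards [(hOo m n).mem_nhds ⟨hx, hne⟩] with y hy
      exact huq m n y hy
  · simp only [htau] at hne
    have hmem : ∀ m' ∈ ({m, m + 1} : Set ℤ), ∀ n' ∈ ({n - 1, n, n + 1} : Set ℤ), x ∈ O m' n' :=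
      fun m' hm' n' hn' => ⟨hx, hne m' hm' n' hn'⟩
    have M0 := hmem m (by simp) n (by simp)
    have M1 := hmem (m + 1) (by simp) n (by simp)
    have P0 := hmem m (by simp) (n + 1) (by simp)
    have P1 := hmem (m + 1) (by simp) (n + 1) (by simp)
    have N0 := hmem m (by simp) (n - 1) (by simp)
    have N1 := hmem (m + 1) (by simp) (n - 1) (by simp)
    -- The two auxiliary tau functions `f = latticeTau (-(m + 1)) m` and
    -- `F = latticeTau (-m) (m + 1)` interpolate between `τ` and `τ̃`: with the shifts `T₊`, `T₋` of
    -- parameters `p₁`, `-p₁`, `τ = T₊ f`, `τ̃ = T₋ f` and `F = T₊ T₋ f`.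
    have b1 := hS.bilinear_pos_neg hx (-(m + 1)) m n
    have b2 := hS.bilinear_pos_zero hx (-(m + 1)) m n
    have b3 := hS.bilinear_neg_zero hx (-(m + 1)) m n
    have b4 := hS.bilinear_neg_zero hx (-m) m (n - 1)
    have b5 := hS.bilinear_pos_zero hx (-(m + 1)) (m + 1) (n - 1)
    have b6 := hS.bilinear_neg_zero hx (-m) m n
    have b7 := hS.bilinear_pos_zero hx (-(m + 1)) m (n - 1)
    simp only [show -(m + 1) + 1 = -m by ring, sub_add_cancel] at b1 b2 b3 b4 b5 b6 b7
    have v0 := hS.two_mul_add_sub_eq hx m n M0.2 M1.2 (hud _ _ _ M0) (hud _ _ _ M1)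
    have vp := hS.two_mul_add_sub_eq hx m (n + 1) P0.2 P1.2 (hud _ _ _ P0) (hud _ _ _ P1)
    have vm := hS.two_mul_add_sub_eq hx m (n - 1) N0.2 N1.2 (hud _ _ _ N0) (hud _ _ _ N1)
    have vloc : (fun s => 2 * S.p₁ + u s m n - u s (m + 1) n) =ᶠ[nhds x] fun s =>
        2 * S.p₁ * (S.latticeTau (-(m + 1)) m n s * S.latticeTau (-m) (m + 1) n s) /
          (S.latticeTau (-m) m n s * S.latticeTau (-(m + 1)) (m + 1) n s) := by
      filter_upwards [(hOo m n).mem_nhds M0, (hOo (m + 1) n).mem_nhds M1] with y h0 h1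
      exact hS.two_mul_add_sub_eq h0.1 m n h0.2 h1.2 (hud _ _ _ h0) (hud _ _ _ h1)
    have hexp : ∀ k, x ∈ O m k → x ∈ O (m + 1) k →
        Complex.exp ((J m k x - J (m + 1) k x) - (J m n x - J (m + 1) n x)) =
          (S.latticeTau (-m) m k x / S.latticeTau (-(m + 1)) (m + 1) k x) /
            (S.latticeTau (-m) m n x / S.latticeTau (-(m + 1)) (m + 1) n x) := by
      intro k h0 h1
      rw [Complex.exp_sub, Complex.exp_sub, Complex.exp_sub, (hJ _ _ x h0).1, (hJ _ _ x h1).1,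
        (hJ _ _ x M0).1, (hJ _ _ x M1).1]
    rw [hexp _ P0 P1] at hp1
    rw [hexp _ N0 N1] at hm1
    have hv' := hv
    rw [v0] at hv'
    have hvn := (div_ne_zero_iff.1 hv').1
    have hp : S.p₁ ≠ 0 := right_ne_zero_of_mul (left_ne_zero_of_mul hvn)
    have hf : S.latticeTau (-(m + 1)) m n x ≠ 0 := left_ne_zero_of_mul (right_ne_zero_of_mul hvn)
    have hF : S.latticeTau (-m) (m + 1) n x ≠ 0 := right_ne_zero_of_mul (right_ne_zero_of_mul hvn)
    have t1 := three_term_of_bilinear b1 b2 b3 hf hp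
    have t2 := three_term_of_bilinear_dual b1 b4 b5 hF hp
    have q1 := quotient_eq_of_three_term (p := S.p₁)
      (g := S.latticeTau (-m) (m + 1) (n + 1) x) M0.2 P0.2 P1.2 hF t1 hp1
    have q2 := quotient_eq_of_three_term (p := S.p₁)
      (g := S.latticeTau (-(m + 1)) m (n - 1) x) M0.2 N0.2 N1.2 hf t2 hm1
    rw [mul_comm (S.latticeTau (-m) (m + 1) (n - 1) x)] at q2
    have hlog : logDeriv (fun s => 2 * S.p₁ + u s m n - u s (m + 1) n) x =
        S.latticeTauDeriv (-(m + 1)) m n x / S.latticeTau (-(m + 1)) m n x +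
        S.latticeTauDeriv (-m) (m + 1) n x / S.latticeTau (-m) (m + 1) n x -
        u x m n - u x (m + 1) n := by
      have h := (((hder x hx (-(m + 1)) m n).mul (hder x hx (-m) (m + 1) n)).const_mul
        (2 * S.p₁)).div ((hder x hx (-m) m n).mul (hder x hx (-(m + 1)) (m + 1) n))
        (mul_ne_zero M0.2 M1.2)
      have h' := h.congr_of_eventuallyEq vloc
      have hT0 := M0.2
      have hT1 := M1.2
      rw [logDeriv_apply, h'.deriv, v0, huq m n x M0, huq (m + 1) n x M1]
      simp only [Pi.mul_apply]
      field_simp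
      ring
    have e6 : S.latticeTauDeriv (-m) (m + 1) n x / S.latticeTau (-m) (m + 1) n x =
        u x m (n + 1) + S.p₁ - S.p₁ * S.latticeTau (-m) m n x *
          S.latticeTau (-m) (m + 1) (n + 1) x /
            (S.latticeTau (-m) (m + 1) n x * S.latticeTau (-m) m (n + 1) x) := by
      have hTp := P0.2
      rw [hud _ _ _ P0] at b6
      field_simp
      linear_combination b6
    have e7 : S.latticeTauDeriv (-(m + 1)) m n x / S.latticeTau (-(m + 1)) m n x =
        u x m (n - 1) + S.p₁ - S.p₁ * S.latticeTau (-m) m n x *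
          S.latticeTau (-(m + 1)) m (n - 1) x /
            (S.latticeTau (-(m + 1)) m n x * S.latticeTau (-m) m (n - 1) x) := by
      have hTm := N0.2
      rw [hud _ _ _ N0] at b7
      field_simp
      linear_combination -b7
    rw [hlog, hexp _ P0 P1, hexp _ N0 N1, vp, vm, q1, q2, e6, e7]
    ring
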